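/- All graphs are simple and undirected, possibly infinite, and $G\to H$ means that there is a graph homomorphism from $G$ to $H$. Write $G+H$ for the join, $G*H$ for the disjunctive product (on $V(G)\times V(H)$, with $(v,w)\sim(v',w')$ iff $v\sim v'$ or $w\sim w'$), $\omega(G)=\sup\{n : K_n\to G\}$, and $G/d$ for the graph whose vertices are the $d$-cliques of $G$, two being adjacent iff they are disjoint and every vertex of one is adjacent to every vertex of the other. A sequence of graphs $(F_n)_{n\in\mathbb N}$ is a semiring family if $F_0=\emptyset$, $F_1\neq\emptyset$, $F_n+F_m\to F_{n+m}$ and $F_n*F_m\to F_{nm}$ for all $n,m$. For a set $S$ of vertices let $S^\perp$ be the set of vertices adjacent to all vertices in $S$; $S$ is a flat if $S^{\perp\perp}=S$, and $\mathrm{rk}(S)=\omega(S^{\perp\perp})$ (the clique number of the induced subgraph). The sequence is linear-like if for every $n$ and every flat $S\subseteq V(F_n)$ the rank $r=\mathrm{rk}(S)$ is finite and the induced subgraph $F_n|_S$ is homomorphically equivalent to $F_r$ (homomorphisms in both directions). The fractional $F$-number of a finite graph $G$ is $\eta_F^{\mathrm f}(G)=\inf\{n/d : n\geq 0,\ d\ge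 1,\ G\to F_n/d\}$. An invariant $\eta$ assigning a nonnegative real to every finite graph is semiring-homomorphic if $\eta(\emptyset)=0$, $\eta(K_1)=1$, $\eta(G)\le\eta(H)$ whenever $G\to H$, $\eta(G+H)=\eta(G)+\eta(H)$ and $\eta(G*H)=\eta(G)\,\eta(H)$. Let $\mathbb F$ be a field with involution $\alpha\mapsto\bar\alpha$ (possibly trivial) whose fixed field is Euclidean, i.e. can be ordered so that every nonnegative element is a square. Let $\langle x,y\rangle=\sum_i \bar x_i y_i$ on $\mathbb F^n$, and let $F_n=\mathbf P^{n-1}(\mathbb F)$ be the projective space of $\mathbb F^n$, with $[x]\sim[y]$ iff $\langle x,y\rangle=0$. 1. $F_n$ is a well-defined (loopless) graph. It is homomorphically equivalent to the orthogonality graph on $\mathbb F^n\setminus\{0\}$ and to the orthogonality graph on the unit vectors $\{x:\langle x,x\rangle=1\}$. The sequence $(F_n)$ is a linear-like semiring family, the set defining $\eta_F^{\mathrm f}(G)$ is nonempty for every finite $G$, and $\eta_F^{\mathrm f}$ is semiring-homomorphic. 2. The fields $\mathbb C$ (with complex conjugation) and $\mathbb R$ (with the identity) satisfy the assumptions, and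 for both of them $\eta_F^{\mathrm f}(G)$ equals, for every finite graph $G$, the projective rank $$\inf\{d/r : r\ge1,\ G \text{ has a } d/r\text{-projective representation}\},$$ where a $d/r$-projective representation assigns to each vertex an orthogonal projection of rank $r$ on $\mathbb C^d$ such that the projections of adjacent vertices have product $0$. 3. Every real closed field with the identity involution satisfies the assumptions, and its fractional number of every finite graph equals the one for $\mathbb R$. 4. Every quadratic extension of a real closed field, with its nontrivial automorphism as involution, satisfies the assumptions, and its fractional number of every finite graph equals the one for $\mathbb C$. -/

import Mathlib

open scoped LinearAlgebra.Projectivization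

universe u v w

namespace GraphInvariant

/-! ### Graphs (possibly infinite): homomorphisms, join, disjunctive product, clique number -/

/-- `G → H`: there is a graph homomorphism from `G` to `H`. -/
def HasHom {V : Type u} {W : Type v} (G : SimpleGraph V) (H : SimpleGraph W) : Prop :=
  Nonempty (G →g H)

/-- `G ≃ H`: homomorphic equivalence. -/
def HomEquivalent {V : Type u} {W : Type v} (G : SimpleGraph V) (H : SimpleGraph W) : Prop :=
  HasHom G H ∧ HasHom H G

/-- The join `G + H`: disjoint union together with all edges between the two parts. -/
def join {V : Type u} {W : Type v} (G : SimpleGraph V) (H : SimpleGraph W) :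
    SimpleGraph (V ⊕ W) where
  Adj x y :=
    match x, y with
    | .inl a, .inl b => G.Adj a b
    | .inr a, .inr b => H.Adj a b
    | .inl _, .inr _ => True
    | .inr _, .inl _ => True
  symm := ⟨by
    rintro (a | a) (b | b) h
    · exact G.adj_symm h
    · trivial
    · trivial
    · exact H.adj_symm h⟩
  loopless := ⟨by
    rintro (a | a) h
    · exact G.irrefl h
    · exact H.irrefl h⟩

/-- The disjunctive product `G * H`. -/
def disjProd {V : Type u} {W : Type v} (G : SimpleGraph V) (H : SimpleGraph W) :
    SimpleGraph (V × W) where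
  Adj x y := G.Adj x.1 y.1 ∨ H.Adj x.2 y.2
  symm := ⟨fun _ _ h => h.imp (fun h => G.adj_symm h) (fun h => H.adj_symm h)⟩
  loopless := ⟨fun _ h => h.elim (fun h => G.irrefl h) (fun h => H.irrefl h)⟩

/-- The clique number `ω(G) = sup {n | K_n → G}`, possibly infinite. -/
noncomputable def cliqueNumber {V : Type u} (G : SimpleGraph V) : ℕ∞ :=
  ⨆ (n : ℕ) (_ : HasHom (⊤ : SimpleGraph (Fin n)) G), (n : ℕ∞)

/-! ### Fractionalization -/

/-- The power graph `2^G`: `S` and `T` are adjacent if they are disjoint and every vertex of `S` is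
adjacent to every vertex of `T`. (The clause `S ≠ T` only removes the loop at the empty set.) -/
def powerGraph {V : Type u} (G : SimpleGraph V) : SimpleGraph (Set V) where
  Adj S T := S ≠ T ∧ Disjoint S T ∧ ∀ s ∈ S, ∀ t ∈ T, G.Adj s t
  symm := ⟨fun _ _ h => ⟨h.1.symm, h.2.1.symm, fun t ht s hs => G.adj_symm (h.2.2 s hs t ht)⟩⟩
  loopless := ⟨fun _ h => h.1 rfl⟩

/-- The `d`-fractionalization `G / d`: the induced subgraph of `2^G` on the `d`-cliques of `G`. -/
def fractionalization {V : Type u} (G : SimpleGraph V) (d : ℕ) :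
    SimpleGraph {S : Set V | G.IsClique S ∧ S.encard = d} :=
  (powerGraph G).induce {S : Set V | G.IsClique S ∧ S.encard = d}

/-! ### Semiring families and the linear-like condition -/

/-- A semiring family of graphs `(F_n)`. -/
structure IsSemiringFamily {X : ℕ → Type v} (F : ∀ n, SimpleGraph (X n)) : Prop where
  isEmpty_zero : IsEmpty (X 0)
  nonempty_one : Nonempty (X 1)
  join_hom : ∀ n m, HasHom (join (F n) (F m)) (F (n + m))
  disjProd_hom : ∀ n m, HasHom (disjProd (F n) (F m)) (F (n * m))

/-- `S^⊥`: the set of all vertices adjacent to all vertices in `S`. -/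
def perp {V : Type u} (G : SimpleGraph V) (S : Set V) : Set V :=
  {v | ∀ s ∈ S, G.Adj v s}

/-- `S` is a flat if `S^⊥⊥ = S`. -/
def IsFlat {V : Type u} (G : SimpleGraph V) (S : Set V) : Prop :=
  perp G (perp G S) = S

/-- The rank `ω(S^⊥⊥)` of a set of vertices. -/
noncomputable def rank {V : Type u} (G : SimpleGraph V) (S : Set V) : ℕ∞ :=
  cliqueNumber (G.induce (perp G (perp G S)))

/-- `(F_n)` is linear-like: every flat `S` of every `F_n` has finite rank `r`, and the subgraph
induced on it is homomorphically equivalent to `F_r`. -/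
def IsLinearLike {X : ℕ → Type v} (F : ∀ n, SimpleGraph (X n)) : Prop :=
  ∀ (n : ℕ) (S : Set (X n)), IsFlat (F n) S →
    ∃ r : ℕ, rank (F n) S = r ∧ HomEquivalent ((F n).induce S) (F r)

/-! ### The fractional `F`-number and semiring-homomorphic invariants -/

/-- The set of all `n / d` with `d ≥ 1` and `G → F_n / d`. -/
def fractionalValues {X : ℕ → Type v} (F : ∀ n, SimpleGraph (X n)) {V : Type u}
    (G : SimpleGraph V) : Set ℝ :=
  {q | ∃ n d : ℕ, 0 < d ∧ HasHom G (fractionalization (F n) d) ∧ q = (n : ℝ) / (d : ℝ)}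

/-- The fractional `F`-number of `G`, the infimum of all `n / d` with `G → F_n / d`. -/
noncomputable def fractionalNumber {X : ℕ → Type v} (F : ∀ n, SimpleGraph (X n)) {V : Type u}
    (G : SimpleGraph V) : ℝ :=
  sInf (fractionalValues F G)

/-- `η` is a semiring-homomorphic invariant of finite graphs: an order-preserving semiring
homomorphism from finite graphs (preordered by existence of homomorphisms, with join as addition
and disjunctive product as multiplication) to the nonnegative reals. -/
structure IsSemiringHomomorphic (η : ∀ V : Type u, SimpleGraph V → ℝ) : Prop where
  nonneg : ∀ (V : Type u) [Finite V] (G : SimpleGraph V), 0 ≤ η V G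
  map_empty : ∀ (V : Type u) [IsEmpty V] (G : SimpleGraph V), η V G = 0
  map_point : ∀ (V : Type u) [Unique V] (G : SimpleGraph V), η V G = 1
  mono : ∀ (V W : Type u) [Finite V] [Finite W] (G : SimpleGraph V) (H : SimpleGraph W),
    HasHom G H → η V G ≤ η W H
  map_join : ∀ (V W : Type u) [Finite V] [Finite W] (G : SimpleGraph V) (H : SimpleGraph W),
    η (V ⊕ W) (join G H) = η V G + η W H
  map_disjProd : ∀ (V W : Type u) [Finite V] [Finite W] (G : SimpleGraph V) (H : SimpleGraph W),
    η (V × W) (disjProd G H) = η V G * η W H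

/-! ### Fields with involution and projective spaces with orthogonality -/

/-- A Euclidean field: a field that can be ordered so that every nonnegative element is a square. -/
def IsEuclideanField (K : Type v) [Field K] : Prop :=
  ∃ _ : LinearOrder K, IsStrictOrderedRing K ∧ ∀ x : K, 0 ≤ x → IsSquare x

/-- The fixed field `{x | star x = x}` of the involution is a Euclidean field. -/
def HasEuclideanFixedField (F : Type v) [Field F] [StarRing F] : Prop :=
  IsEuclideanField (selfAdjoint F)

/-- The standard hermitian form `⟨x, y⟩ = ∑ i, star (x i) * y i` on `F^n`. -/
def hermForm {F : Type v} [Field F] [StarRing F] {n : ℕ} (x y : Fin n → F) : F :=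
  ∑ i, star (x i) * y i

theorem star_hermForm {F : Type v} [Field F] [StarRing F] {n : ℕ} (x y : Fin n → F) :
    star (hermForm x y) = hermForm y x := by
  simp [hermForm, star_sum, mul_comm]

/-- Orthogonality as adjacency on a set of vectors in `F^n`. (If the form is anisotropic and the
vectors are nonzero, the clause `x ≠ y` is automatic.) -/
def vectorGraph {F : Type v} [Field F] [StarRing F] {n : ℕ} (S : Set (Fin n → F)) :
    SimpleGraph S where
  Adj x y := x ≠ y ∧ hermForm x.1 y.1 = 0
  symm := ⟨fun x y h => ⟨h.1.symm, by rw [← star_hermForm, h.2, star_zero]⟩⟩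
  loopless := ⟨fun _ h => h.1 rfl⟩

/-- The projective space `P^{n-1}(F)` with orthogonality as adjacency. (If the form is anisotropic,
the clause `p ≠ q` is automatic.) -/
def projectiveGraph (F : Type v) [Field F] [StarRing F] (n : ℕ) :
    SimpleGraph (ℙ F (Fin n → F)) where
  Adj p q := p ≠ q ∧ hermForm p.rep q.rep = 0
  symm := ⟨fun x y h => ⟨h.1.symm, by rw [← star_hermForm, h.2, star_zero]⟩⟩
  loopless := ⟨fun _ h => h.1 rfl⟩

/-! ### Projective rank -/

/-- A `d/r`-projective representation of `G`: an assignment of orthogonal projections of rank `r`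
on `ℂ^d` to the vertices, such that adjacent vertices receive orthogonal projections. -/
def IsProjectiveRepresentation {V : Type u} (G : SimpleGraph V) (d r : ℕ)
    (P : V → Matrix (Fin d) (Fin d) ℂ) : Prop :=
  (∀ v, IsStarProjection (P v) ∧ (P v).rank = r) ∧ ∀ v w, G.Adj v w → P v * P w = 0

/-- The projective rank of `G`: the infimum of all `d / r`, `r ≥ 1`, such that `G` has a
`d/r`-projective representation. -/
noncomputable def projectiveRank {V : Type u} (G : SimpleGraph V) : ℝ :=
  sInf {q | ∃ d r : ℕ, 0 < r ∧ (∃ P, IsProjectiveRepresentation G d r P) ∧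
    q = (d : ℝ) / (r : ℝ)}

end GraphInvariant

/-!
Let `F` be a field with involution whose fixed field is Euclidean. Since `star a * a` is nonnegative
in the fixed field (`exists_order_star_mul_self_nonneg`), the form `star x ⬝ᵥ y` on `F^n` is
anisotropic and vectors can be normalized, so every subspace has an orthonormal basis
(`exists_isOrthonormal_span_eq`). Homomorphisms from `G` to the `d`-fractionalization of projective
space then amount to assignments of orthonormal `d`-frames to the vertices of `G` that are
orthogonal for adjacent vertices (`HasFrames`, `hasHom_fractionalization_iff`).

The flats of projective space are its linear subspaces, which gives the linear-like condition. Direct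
sums and tensor products of frames show that the fractional number is subadditive and
submultiplicative. The reverse inequalities hold because frames can be rewritten inside any subspace
containing them (`HasFrames.of_mem`). For the join, the two sets of frames span orthogonal subspaces.
For the disjunctive product, the frames over the vertices of one factor span a family of subspaces
that represents this factor, while each of the subspaces represents the other factor.

Over `ℂ` a frame is an orthonormal basis of the range of a projection, whence the projective rank.
If `C = R(i)`, restriction of scalars doubles both the dimension and the number of vectors of a frame
(`HasFrames.restrictScalars`), so `C` and `R` have the same fractional numbers.

A real closed field `R` represents the same graphs by frames as `ℝ`. From `R` to `ℝ` one takes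
standard parts, since the coordinates of unit vectors are bounded (`HasFrames.to_real`). From `ℝ`
to `R` one applies a ring homomorphism to `R` from the `ℚ`-algebra generated by the coordinates. It
exists by a form of the Artin–Lang theorem (`exists_ringHom_of_fg`): by Noether normalization and
the primitive element theorem the given real point is a simple real root of a polynomial with
parameters. This root produces a sign change, which persists when the parameters are moved to nearby
rational numbers and forces a root in `R`. The intermediate value theorem over `R` needed here
follows from the fact that irreducible polynomials have degree at most two
(`natDegree_le_two_of_irreducible`), which is proved by Galois theory.
-/

namespace GraphInvariant

/-! ### Positivity of the standard hermitian form -/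

section Form

variable {F : Type*} [Field F] [StarRing F] {ι κ : Type*} [Fintype κ]

open Matrix

theorem star_star_dotProduct (x y : κ → F) : star (star x ⬝ᵥ y) = star y ⬝ᵥ x := by
  simp [dotProduct, star_sum, mul_comm]

theorem star_dotProduct_eq_zero_comm {x y : κ → F} :
    star x ⬝ᵥ y = 0 ↔ star y ⬝ᵥ x = 0 := by
  rw [← star_star_dotProduct, star_eq_zero]

theorem star_smul_dotProduct_smul (a b : F) (x y : κ → F) :
    star (a • x) ⬝ᵥ (b • y) = star a * b * (star x ⬝ᵥ y) := by
  rw [star_smul, smul_dotProduct, dotProduct_smul, smul_eq_mul, smul_eq_mul, mul_assoc]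

/-- Norms are nonnegative for the ordering of a Euclidean fixed field. A skew element has a
nonpositive square, for otherwise it would be `±` a fixed element; so in
`4 star a * a = (a + star a) ^ 2 - (a - star a) ^ 2` both terms are nonnegative. -/
theorem exists_order_star_mul_self_nonneg (hF : HasEuclideanFixedField F) :
    ∃ _ : LinearOrder (selfAdjoint F), IsStrictOrderedRing (selfAdjoint F) ∧
      (∀ x : selfAdjoint F, 0 ≤ x → IsSquare x) ∧
      ∀ a : F, 0 ≤ (⟨star a * a, IsSelfAdjoint.star_mul_self a⟩ : selfAdjoint F) := by
  obtain ⟨o, ho, hsq⟩ := hF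
  refine ⟨o, ho, hsq, fun a => ?_⟩
  set N : selfAdjoint F := ⟨star a * a, IsSelfAdjoint.star_mul_self a⟩ with hN
  have hs : IsSelfAdjoint (a + star a) := by simp [IsSelfAdjoint, add_comm]
  have hk : IsSelfAdjoint ((a - star a) * (a - star a)) := by
    simp only [IsSelfAdjoint, star_mul, star_sub, star_star]; ring
  set u : selfAdjoint F := ⟨a + star a, hs⟩ with hu
  set k : selfAdjoint F := ⟨(a - star a) * (a - star a), hk⟩ with hk'
  have key : 4 * N = u * u - k := by
    apply Subtype.ext
    change (4 : F) * (star a * a) = (a + star a) * (a + star a) - (a - star a) * (a - star a)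
    ring
  have hk0 : k ≤ 0 := by
    by_contra hlt
    push Not at hlt
    obtain ⟨c, hc⟩ := hsq k hlt.le
    have hc' : (a - star a) * (a - star a) = (c : F) * c := congrArg Subtype.val hc
    have h2 : (2 : selfAdjoint F) ≠ 0 := two_ne_zero
    have h2' : (2 : F) ≠ 0 := fun h => h2 (Subtype.ext h)
    have hself : star (a - star a) = a - star a := by
      have hcs : star (c : F) = c := c.2
      rcases mul_self_eq_mul_self_iff.mp hc' with h | h
      · rw [h, hcs]
      · rw [h, star_neg, hcs]
    have h0 : a - star a = 0 := by
      rw [star_sub, star_star] at hself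
      have : (2 : F) * (a - star a) = 0 := by linear_combination -hself
      exact (mul_eq_zero.mp this).resolve_left h2'
    have : k = 0 := Subtype.ext (by change (a - star a) * (a - star a) = 0; rw [h0, zero_mul])
    exact hlt.ne' this
  nlinarith [mul_self_nonneg u]

theorem two_ne_zero_of_hasEuclideanFixedField (hF : HasEuclideanFixedField F) : (2 : F) ≠ 0 := by
  obtain ⟨o, ho, -⟩ := hF
  exact fun h => (two_ne_zero : (2 : selfAdjoint F) ≠ 0) (Subtype.ext h)

theorem coe_sum_norm (x : κ → F) :
    ((∑ k, ⟨star (x k) * x k, IsSelfAdjoint.star_mul_self (x k)⟩ : selfAdjoint F) : F) =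
      star x ⬝ᵥ x := by
  simp [dotProduct]

theorem eq_zero_of_star_dotProduct_self (hF : HasEuclideanFixedField F) {x : κ → F}
    (hx : star x ⬝ᵥ x = 0) : x = 0 := by
  obtain ⟨o, ho, -, hpos⟩ := exists_order_star_mul_self_nonneg hF
  have h0 : (∑ k, ⟨star (x k) * x k, IsSelfAdjoint.star_mul_self (x k)⟩ : selfAdjoint F) = 0 :=
    Subtype.ext ((coe_sum_norm x).trans hx)
  rw [Finset.sum_eq_zero_iff_of_nonneg fun k _ => hpos (x k)] at h0
  funext k
  have := congrArg Subtype.val (h0 k (Finset.mem_univ k))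
  simpa using this

theorem exists_star_dotProduct_self_eq_mul_self (hF : HasEuclideanFixedField F) (x : κ → F) :
    ∃ c : F, star c = c ∧ star x ⬝ᵥ x = c * c := by
  obtain ⟨o, ho, hsq, hpos⟩ := exists_order_star_mul_self_nonneg hF
  obtain ⟨c, hc⟩ := hsq _ (Finset.sum_nonneg fun k (_ : k ∈ Finset.univ) => hpos (x k))
  exact ⟨c, c.2, by rw [← coe_sum_norm, hc]; rfl⟩

theorem exists_unit_smul (hF : HasEuclideanFixedField F) {x : κ → F} (hx : x ≠ 0) :
    ∃ c : F, c ≠ 0 ∧ star (c • x) ⬝ᵥ (c • x) = 1 := by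
  obtain ⟨c, hc, h⟩ := exists_star_dotProduct_self_eq_mul_self hF x
  have hc0 : c ≠ 0 := by
    rintro rfl
    exact hx (eq_zero_of_star_dotProduct_self hF (by simpa using h))
  refine ⟨c⁻¹, inv_ne_zero hc0, ?_⟩
  rw [star_smul_dotProduct_smul, h, star_inv₀, hc]
  field_simp

/-! ### Orthonormal families -/

/-- A family of vectors that is orthonormal for the standard hermitian form. -/
structure IsOrthonormal (e : ι → κ → F) : Prop where
  unit : ∀ i, star (e i) ⬝ᵥ e i = 1
  orth : ∀ i j, i ≠ j → star (e i) ⬝ᵥ e j = 0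

namespace IsOrthonormal

variable {e : ι → κ → F}

theorem eq_ite [DecidableEq ι] (he : IsOrthonormal e) (i j : ι) :
    star (e i) ⬝ᵥ e j = if i = j then 1 else 0 := by
  split_ifs with h
  · rw [h, he.unit]
  · exact he.orth i j h

theorem comp_injective {ι' : Type*} (he : IsOrthonormal e) {f : ι' → ι}
    (hf : Function.Injective f) : IsOrthonormal (e ∘ f) :=
  ⟨fun _ => he.unit _, fun _ _ h => he.orth _ _ (hf.ne h)⟩

theorem ne_zero (he : IsOrthonormal e) (i : ι) : e i ≠ 0 := by
  intro h
  have := he.unit i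
  rw [h, dotProduct_zero] at this
  exact zero_ne_one this

theorem star_dotProduct_sum [Fintype ι] (he : IsOrthonormal e) (c : ι → F) (i : ι) :
    star (e i) ⬝ᵥ (∑ j, c j • e j) = c i := by
  classical
  rw [dotProduct_sum]
  simp [dotProduct_smul, he.eq_ite]

theorem linearIndependent [Fintype ι] (he : IsOrthonormal e) : LinearIndependent F e := by
  rw [Fintype.linearIndependent_iff]
  intro c hc i
  rw [← he.star_dotProduct_sum c i, hc, dotProduct_zero]

theorem card_le_finrank [Fintype ι] (he : IsOrthonormal e) {U : Submodule F (κ → F)}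
    (hU : ∀ i, e i ∈ U) : Fintype.card ι ≤ Module.finrank F U := by
  have h : LinearIndependent F (fun i => (⟨e i, hU i⟩ : U)) :=
    LinearIndependent.of_comp U.subtype he.linearIndependent
  exact h.fintype_card_le_finrank

theorem card_le [Fintype ι] (he : IsOrthonormal e) : Fintype.card ι ≤ Fintype.card κ := by
  simpa using he.linearIndependent.fintype_card_le_finrank

theorem sum_elim {ι' : Type*} {e' : ι' → κ → F} (he : IsOrthonormal e) (he' : IsOrthonormal e')
    (h : ∀ i j, star (e i) ⬝ᵥ e' j = 0) : IsOrthonormal (Sum.elim e e') := by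
  refine ⟨?_, ?_⟩
  · rintro (i | i)
    · exact he.unit i
    · exact he'.unit i
  · rintro (i | i) (j | j) hij
    · exact he.orth i j fun h => hij (congrArg _ h)
    · exact h i j
    · exact star_dotProduct_eq_zero_comm.mp (h j i)
    · exact he'.orth i j fun h => hij (congrArg _ h)

/-- Parseval: in the span of an orthonormal family the form is computed by coordinates. -/
theorem parseval [Fintype ι] (he : IsOrthonormal e) {x y : κ → F}
    (hy : y ∈ Submodule.span F (Set.range e)) :
    star (fun i => star (e i) ⬝ᵥ x) ⬝ᵥ (fun i => star (e i) ⬝ᵥ y) = star x ⬝ᵥ y := by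
  obtain ⟨c, rfl⟩ := (Submodule.mem_span_range_iff_exists_fun F).mp hy
  simp only [he.star_dotProduct_sum, dotProduct_sum, dotProduct_smul]
  rw [dotProduct]
  refine Finset.sum_congr rfl fun i _ => ?_
  rw [Pi.star_apply, star_star_dotProduct, smul_eq_mul, mul_comm]

/-- The map with coordinates `c ↦ ∑ i, c i • e i` preserves the form. -/
theorem star_sum_dotProduct_sum [Fintype ι] (he : IsOrthonormal e) (c d : ι → F) :
    star (∑ i, c i • e i) ⬝ᵥ (∑ i, d i • e i) = star c ⬝ᵥ d := by
  rw [← he.parseval (Submodule.sum_mem _ fun i _ =>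
    Submodule.smul_mem _ _ (Submodule.subset_span ⟨i, rfl⟩))]
  simp only [he.star_dotProduct_sum]

end IsOrthonormal

/-- Every subspace has an orthonormal basis: an orthonormal family of the largest possible size
spans, since the component of a vector orthogonal to it could be normalized and added. -/
theorem exists_isOrthonormal_span_eq (hF : HasEuclideanFixedField F) (U : Submodule F (κ → F)) :
    ∃ e : Fin (Module.finrank F U) → κ → F,
      IsOrthonormal e ∧ Submodule.span F (Set.range e) = U := by
  classical
  let p : ℕ → Prop := fun r => ∃ e : Fin r → κ → F, IsOrthonormal e ∧ ∀ i, e i ∈ U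
  have hb : ∀ r, p r → r ≤ Module.finrank F U := by
    rintro r ⟨e, he, heU⟩
    simpa using he.card_le_finrank heU
  have hp0 : p 0 := ⟨Fin.elim0, ⟨(·.elim0), (·.elim0)⟩, (·.elim0)⟩
  set r := Nat.findGreatest p (Module.finrank F U) with hr
  obtain ⟨e, he, heU⟩ : p r := Nat.findGreatest_spec (Nat.zero_le _) hp0
  have hmax : ¬ p (r + 1) := fun h => by
    have := Nat.le_findGreatest (hb _ h) h
    omega
  have hspan : Submodule.span F (Set.range e) = U := by
    refine le_antisymm (Submodule.span_le.mpr (by rintro _ ⟨i, rfl⟩; exact heU i)) fun x hx => ?_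
    by_contra hxs
    set y := x - ∑ i, (star (e i) ⬝ᵥ x) • e i with hy
    have hsum : ∑ i, (star (e i) ⬝ᵥ x) • e i ∈ Submodule.span F (Set.range e) :=
      Submodule.sum_mem _ fun i _ => Submodule.smul_mem _ _ (Submodule.subset_span ⟨i, rfl⟩)
    have hy0 : y ≠ 0 := fun h => hxs (by rwa [← sub_eq_zero.mp h] at hsum)
    have hyU : y ∈ U := U.sub_mem hx
      (U.sum_mem fun i _ => U.smul_mem _ (heU i))
    have hortho : ∀ i, star (e i) ⬝ᵥ y = 0 := fun i => by
      rw [hy, dotProduct_sub, he.star_dotProduct_sum, sub_self]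
    obtain ⟨c, hc, hcy⟩ := exists_unit_smul hF hy0
    have hnew : IsOrthonormal (Sum.elim e fun _ : Fin 1 => c • y) :=
      he.sum_elim ⟨fun _ => hcy, fun i j h => absurd (Subsingleton.elim i j) h⟩
        fun i _ => by rw [dotProduct_smul, hortho, smul_zero]
    refine hmax ⟨_, hnew.comp_injective finSumFinEquiv.symm.injective, fun i => ?_⟩
    rcases h : finSumFinEquiv.symm i with j | j
    · simpa [h] using heU j
    · simpa [h] using U.smul_mem c hyU
  have hrank : Module.finrank F U = r := by
    rw [← hspan, finrank_span_eq_card he.linearIndependent, Fintype.card_fin]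
  rw [hrank]
  exact ⟨e, he, hspan⟩

theorem finrank_add_finrank_le_of_orthogonal (hF : HasEuclideanFixedField F)
    {U U' : Submodule F (κ → F)} (h : ∀ x ∈ U, ∀ y ∈ U', star x ⬝ᵥ y = 0) :
    Module.finrank F U + Module.finrank F U' ≤ Fintype.card κ := by
  obtain ⟨e, he, hs⟩ := exists_isOrthonormal_span_eq hF U
  obtain ⟨e', he', hs'⟩ := exists_isOrthonormal_span_eq hF U'
  have := (he.sum_elim he' fun i j => h _ (hs ▸ Submodule.subset_span ⟨i, rfl⟩) _
    (hs' ▸ Submodule.subset_span ⟨j, rfl⟩)).card_le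
  simpa using this

theorem orthogonal_span_span {s t : Set (κ → F)} (h : ∀ x ∈ s, ∀ y ∈ t, star x ⬝ᵥ y = 0) :
    ∀ x ∈ Submodule.span F s, ∀ y ∈ Submodule.span F t, star x ⬝ᵥ y = 0 := by
  intro x hx y hy
  induction hx, hy using Submodule.span_induction₂ with
  | mem_mem x y hx hy => exact h x hx y hy
  | zero_left y hy => simp
  | zero_right x hx => simp
  | add_left x y z _ _ _ h1 h2 => rw [star_add, add_dotProduct, h1, h2, add_zero]
  | add_right x y z _ _ _ h1 h2 => rw [dotProduct_add, h1, h2, add_zero]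
  | smul_left r x y _ _ h1 => rw [star_smul, smul_dotProduct, h1, smul_zero]
  | smul_right r x y _ _ h1 => rw [dotProduct_smul, h1, smul_zero]

end Form

/-! ### Orthogonality on projective space -/

section Projective

variable {F : Type*} [Field F] [StarRing F] {n : ℕ}

open Matrix

theorem projectiveGraph_adj_mk_iff (hF : HasEuclideanFixedField F) (x y : Fin n → F)
    (hx : x ≠ 0) (hy : y ≠ 0) :
    (projectiveGraph F n).Adj (Projectivization.mk F x hx) (Projectivization.mk F y hy) ↔
      star x ⬝ᵥ y = 0 := by
  obtain ⟨a, ha⟩ := Projectivization.exists_smul_eq_mk_rep F x hx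
  obtain ⟨b, hb⟩ := Projectivization.exists_smul_eq_mk_rep F y hy
  have h : hermForm (Projectivization.mk F x hx).rep (Projectivization.mk F y hy).rep =
      star (a : F) * b * (star x ⬝ᵥ y) := by
    rw [← ha, ← hb]
    exact star_smul_dotProduct_smul (a : F) (b : F) x y
  have ha0 : star (a : F) ≠ 0 := star_ne_zero.mpr a.ne_zero
  constructor
  · rintro ⟨-, h0⟩
    rw [h] at h0
    simpa [ha0] using h0
  · intro h0
    refine ⟨fun hxy => ?_, by rw [h, h0, mul_zero]⟩
    obtain ⟨c, hc⟩ := (Projectivization.mk_eq_mk_iff' F x y hx hy).mp hxy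
    rw [← hc, star_smul, smul_dotProduct, smul_eq_zero] at h0
    rcases h0 with h0 | h0
    · rw [star_eq_zero] at h0
      exact hx (by rw [← hc, h0, zero_smul])
    · exact hy (eq_zero_of_star_dotProduct_self hF h0)

theorem projectiveGraph_adj_iff (hF : HasEuclideanFixedField F) (p q : ℙ F (Fin n → F)) :
    (projectiveGraph F n).Adj p q ↔ star p.rep ⬝ᵥ q.rep = 0 := by
  rw [← projectiveGraph_adj_mk_iff hF _ _ p.rep_nonzero q.rep_nonzero, p.mk_rep, q.mk_rep]

theorem hasHom_projectiveGraph (hF : HasEuclideanFixedField F) {V : Type*} {G : SimpleGraph V}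
    (x : V → Fin n → F) (hx : ∀ v, x v ≠ 0) (h : ∀ v w, G.Adj v w → star (x v) ⬝ᵥ x w = 0) :
    HasHom G (projectiveGraph F n) :=
  ⟨⟨fun v => Projectivization.mk F (x v) (hx v), fun {v w} hvw =>
    (projectiveGraph_adj_mk_iff hF _ _ _ _).mpr (h v w hvw)⟩⟩

theorem exists_unit_rep (hF : HasEuclideanFixedField F) (p : ℙ F (Fin n → F)) :
    ∃ (x : Fin n → F) (hx : x ≠ 0), Projectivization.mk F x hx = p ∧ star x ⬝ᵥ x = 1 := by
  obtain ⟨c, hc, h⟩ := exists_unit_smul hF p.rep_nonzero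
  refine ⟨c • p.rep, smul_ne_zero hc p.rep_nonzero, ?_, h⟩
  conv_rhs => rw [← p.mk_rep]
  exact (Projectivization.mk_eq_mk_iff' F _ _ _ _).mpr ⟨c, rfl⟩

theorem homEquivalent_vectorGraph_ne_zero (hF : HasEuclideanFixedField F) :
    HomEquivalent (projectiveGraph F n) (vectorGraph {x : Fin n → F | x ≠ 0}) := by
  refine ⟨⟨⟨fun p => ⟨p.rep, p.rep_nonzero⟩, fun {p q} h => ⟨fun hpq => h.1 ?_, h.2⟩⟩⟩,
    hasHom_projectiveGraph hF (fun x => x.1) (fun x => x.2) fun x y h => h.2⟩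
  have : p.rep = q.rep := congrArg Subtype.val hpq
  rw [← p.mk_rep, ← q.mk_rep]
  congr

theorem homEquivalent_vectorGraph_unit (hF : HasEuclideanFixedField F) :
    HomEquivalent (projectiveGraph F n)
      (vectorGraph {x : Fin n → F | hermForm x x = 1}) := by
  choose x hx hmk hu using exists_unit_rep (n := n) hF
  refine ⟨⟨⟨fun p => ⟨x p, hu p⟩, fun {p q} h => ⟨fun hpq => h.1 ?_, ?_⟩⟩⟩,
    hasHom_projectiveGraph hF (fun x => x.1) (fun x h => ?_) fun x y h => h.2⟩
  · have : x p = x q := congrArg Subtype.val hpq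
    rw [← hmk p, ← hmk q]
    congr
  · rw [← hmk p, ← hmk q] at h
    exact (projectiveGraph_adj_mk_iff hF _ _ _ _).mp h
  · have h1 : hermForm x.1 x.1 = 1 := x.2
    rw [h] at h1
    exact zero_ne_one ((dotProduct_zero _).symm.trans h1)

end Projective

/-! ### Assignments of orthonormal frames -/

section Frames

variable {F : Type*} [Field F] [StarRing F]
  {V W ι ι' κ κ' : Type*} [Fintype κ] [Fintype κ']

open Matrix

/-- `G` can be represented by orthonormal frames: each vertex is assigned an orthonormal family
indexed by `ι` in `F^κ` such that the families of adjacent vertices are orthogonal. For nonempty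
`ι`, and up to the names of the index sets, this is a homomorphism from `G` to the
`|ι|`-fractionalization of the projective space of `F^κ`. -/
def HasFrames (F : Type*) [Field F] [StarRing F] {V : Type*} (G : SimpleGraph V)
    (κ ι : Type*) [Fintype κ] : Prop :=
  ∃ e : V → ι → κ → F, (∀ v, IsOrthonormal (e v)) ∧
    ∀ v w, G.Adj v w → ∀ i j, star (e v i) ⬝ᵥ e w j = 0

theorem HasFrames.of_hom {G : SimpleGraph V} {H : SimpleGraph W} (h : HasHom G H)
    (hH : HasFrames F H κ ι) : HasFrames F G κ ι := by
  obtain ⟨φ⟩ := h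
  obtain ⟨e, he, ho⟩ := hH
  exact ⟨fun v => e (φ v), fun v => he _, fun v w hvw => ho _ _ (φ.map_adj hvw)⟩

theorem star_reindex_dotProduct_reindex (f : κ ≃ κ') (x y : κ → F) :
    star (x ∘ f.symm) ⬝ᵥ (y ∘ f.symm) = star x ⬝ᵥ y :=
  comp_equiv_dotProduct_comp_equiv (star x) y f.symm

theorem HasFrames.reindex {G : SimpleGraph V} (f : κ ≃ κ') (g : ι' ↪ ι)
    (hG : HasFrames F G κ ι) : HasFrames F G κ' ι' := by
  obtain ⟨e, he, ho⟩ := hG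
  refine ⟨fun v i => e v (g i) ∘ f.symm, fun v => ⟨fun i => ?_, fun i j hij => ?_⟩,
    fun v w hvw i j => ?_⟩
  · rw [star_reindex_dotProduct_reindex, (he v).unit]
  · rw [star_reindex_dotProduct_reindex, (he v).orth _ _ (g.injective.ne hij)]
  · rw [star_reindex_dotProduct_reindex, ho v w hvw]

theorem star_tensor_dotProduct_tensor (x x' : κ → F) (y y' : κ' → F) :
    star (fun k : κ × κ' => x k.1 * y k.2) ⬝ᵥ (fun k : κ × κ' => x' k.1 * y' k.2) =
      (star x ⬝ᵥ x') * (star y ⬝ᵥ y') := by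
  simp only [dotProduct, Pi.star_apply, Fintype.sum_prod_type, Finset.sum_mul_sum, star_mul]
  refine Finset.sum_congr rfl fun i _ => Finset.sum_congr rfl fun j _ => by ring

theorem star_sumElim_dotProduct_sumElim (x x' : κ → F) (y y' : κ' → F) :
    star (Sum.elim x y) ⬝ᵥ Sum.elim x' y' = star x ⬝ᵥ x' + star y ⬝ᵥ y' := by
  simp [dotProduct]

theorem HasFrames.disjProd {G : SimpleGraph V} {H : SimpleGraph W} (hG : HasFrames F G κ ι)
    (hH : HasFrames F H κ' ι') : HasFrames F (disjProd G H) (κ × κ') (ι × ι') := by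
  obtain ⟨e, he, ho⟩ := hG
  obtain ⟨e', he', ho'⟩ := hH
  refine ⟨fun v i k => e v.1 i.1 k.1 * e' v.2 i.2 k.2, fun v => ⟨fun i => ?_, fun i j hij => ?_⟩,
    fun v w hvw i j => ?_⟩
  · rw [star_tensor_dotProduct_tensor, (he _).unit, (he' _).unit, one_mul]
  · rw [star_tensor_dotProduct_tensor]
    by_cases h : i.1 = j.1
    · rw [(he' _).orth _ _ fun h' => hij (Prod.ext h h'), mul_zero]
    · rw [(he _).orth _ _ h, zero_mul]
  · rw [star_tensor_dotProduct_tensor]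
    rcases hvw with h | h
    · rw [ho _ _ h, zero_mul]
    · rw [ho' _ _ h, mul_zero]

theorem HasFrames.join {G : SimpleGraph V} {H : SimpleGraph W} (hG : HasFrames F G κ ι)
    (hH : HasFrames F H κ' ι) : HasFrames F (join G H) (κ ⊕ κ') ι := by
  obtain ⟨e, he, ho⟩ := hG
  obtain ⟨e', he', ho'⟩ := hH
  refine ⟨Sum.elim (fun v i => Sum.elim (e v i) 0) (fun w i => Sum.elim 0 (e' w i)), ?_, ?_⟩
  · rintro (v | v)
    · refine ⟨fun i => ?_, fun i j hij => ?_⟩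
      · simp [star_sumElim_dotProduct_sumElim, (he v).unit]
      · simp [star_sumElim_dotProduct_sumElim, (he v).orth _ _ hij]
    · refine ⟨fun i => ?_, fun i j hij => ?_⟩
      · simp [star_sumElim_dotProduct_sumElim, (he' v).unit]
      · simp [star_sumElim_dotProduct_sumElim, (he' v).orth _ _ hij]
  · rintro (v | v) (w | w) hvw i j
    · simp [star_sumElim_dotProduct_sumElim, ho v w hvw]
    · simp [star_sumElim_dotProduct_sumElim]
    · simp [star_sumElim_dotProduct_sumElim]
    · simp [star_sumElim_dotProduct_sumElim, ho' v w hvw]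

theorem isOrthonormal_single [DecidableEq κ] :
    IsOrthonormal (fun k : κ => (Pi.single k 1 : κ → F)) := by
  refine ⟨fun i => ?_, fun i j hij => ?_⟩
  · simp
  · simp [hij.symm]

/-- Tensoring with the standard frame of `F^κ'` multiplies dimension and rank by `|κ'|`. -/
theorem HasFrames.scale {G : SimpleGraph V} (hG : HasFrames F G κ ι) (κ' : Type*) [Fintype κ'] :
    HasFrames F G (κ × κ') (ι × κ') := by
  classical
  have h1 : HasFrames F (⊥ : SimpleGraph Unit) κ' κ' :=
    ⟨fun _ k => Pi.single k 1, fun _ => isOrthonormal_single, fun v w h => h.elim⟩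
  exact (hG.disjProd h1).of_hom ⟨⟨fun v => (v, ()), fun h => Or.inl h⟩⟩

/-- Frames contained in a subspace `U` can be written in coordinates for an orthonormal basis of
`U`. -/
theorem HasFrames.of_mem {G : SimpleGraph V} (hF : HasEuclideanFixedField F)
    {e : V → ι → κ → F} (he : ∀ v, IsOrthonormal (e v))
    (ho : ∀ v w, G.Adj v w → ∀ i j, star (e v i) ⬝ᵥ e w j = 0)
    (U : Submodule F (κ → F)) (hU : ∀ v i, e v i ∈ U) :
    HasFrames F G (Fin (Module.finrank F U)) ι := by
  obtain ⟨b, hb, hs⟩ := exists_isOrthonormal_span_eq hF U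
  have hmem : ∀ v i, e v i ∈ Submodule.span F (Set.range b) := fun v i => by rw [hs]; exact hU v i
  refine ⟨fun v i k => star (b k) ⬝ᵥ e v i, fun v => ⟨fun i => ?_, fun i j hij => ?_⟩,
    fun v w hvw i j => ?_⟩
  · rw [hb.parseval (hmem v i), (he v).unit]
  · rw [hb.parseval (hmem v j), (he v).orth i j hij]
  · rw [hb.parseval (hmem w j), ho v w hvw]

/-- A `d`-clique in projective space is an orthogonal frame up to scalars, and can be normalized.
For `d = 0` all cliques are empty, and the power graph has no edge at the empty set. -/
theorem hasHom_fractionalization_iff (hF : HasEuclideanFixedField F) {G : SimpleGraph V} {n d : ℕ}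
    (hd : 0 < d) :
    HasHom G (fractionalization (projectiveGraph F n) d) ↔ HasFrames F G (Fin n) (Fin d) := by
  constructor
  · rintro ⟨φ⟩
    choose x hx hmk hu using exists_unit_rep (n := n) hF
    have hadj : ∀ p q, (projectiveGraph F n).Adj p q → star (x p) ⬝ᵥ x q = 0 := fun p q h => by
      rw [← hmk p, ← hmk q] at h
      exact (projectiveGraph_adj_mk_iff hF _ _ _ _).mp h
    have hequiv : ∀ v, Nonempty (Fin d ≃ (φ v).1) := fun v => by
      have hc : (φ v).1.encard = d := (φ v).2.2
      have hfin : Finite (φ v).1 := Set.finite_of_encard_eq_coe hc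
      exact ⟨(Finite.equivFinOfCardEq (by
        rw [Nat.card_coe_set_eq, Set.ncard, hc]; rfl)).symm⟩
    have f : ∀ v, Fin d ≃ (φ v).1 := fun v => (hequiv v).some
    refine ⟨fun v i => x (f v i), fun v => ⟨fun i => hu _, fun i j hij => hadj _ _ ?_⟩,
      fun v w hvw i j => hadj _ _ ?_⟩
    · exact (φ v).2.1 (f v i).2 (f v j).2 fun h => hij ((f v).injective (Subtype.ext h))
    · exact (φ.map_adj hvw).2.2 _ (f v i).2 _ (f w j).2
  · rintro ⟨e, he, ho⟩
    let p : V → Fin d → ℙ F (Fin n → F) := fun v i =>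
      Projectivization.mk F (e v i) ((he v).ne_zero i)
    have hp : ∀ v i j, i ≠ j → (projectiveGraph F n).Adj (p v i) (p v j) := fun v i j hij =>
      (projectiveGraph_adj_mk_iff hF _ _ _ _).mpr ((he v).orth i j hij)
    have hpw : ∀ v w, G.Adj v w → ∀ i j, (projectiveGraph F n).Adj (p v i) (p w j) :=
      fun v w hvw i j => (projectiveGraph_adj_mk_iff hF _ _ _ _).mpr (ho v w hvw i j)
    have hinj : ∀ v, Function.Injective (p v) := fun v i j hij => by
      by_contra hne
      exact (hp v i j hne).ne hij
    refine ⟨⟨fun v => ⟨Set.range (p v), ?_, ?_⟩, fun {v w} hvw => ?_⟩⟩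
    · rintro _ ⟨i, rfl⟩ _ ⟨j, rfl⟩ hij
      exact hp v i j fun h => hij (congrArg _ h)
    · rw [← Set.image_univ, (hinj v).encard_image, Set.encard_univ]
      simp
    · have hdisj : Disjoint (Set.range (p v)) (Set.range (p w)) := by
        rw [Set.disjoint_left]
        rintro _ ⟨i, rfl⟩ ⟨j, hj⟩
        exact (hpw v w hvw i j).ne hj.symm
      refine ⟨fun h => ?_, hdisj, ?_⟩
      · have h' : Set.range (p v) = Set.range (p w) := h
        rw [← h', disjoint_self] at hdisj
        exact (Set.range_nonempty_iff_nonempty.mpr ⟨⟨0, hd⟩⟩).ne_empty hdisj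
      · rintro _ ⟨i, rfl⟩ _ ⟨j, rfl⟩
        exact hpw v w hvw i j

theorem mem_fractionalValues_iff (hF : HasEuclideanFixedField F) {G : SimpleGraph V} {q : ℝ} :
    q ∈ fractionalValues (projectiveGraph F) G ↔
      ∃ n d : ℕ, 0 < d ∧ HasFrames F G (Fin n) (Fin d) ∧ q = (n : ℝ) / d := by
  refine exists_congr fun n => exists_congr fun d => and_congr_right fun hd => ?_
  rw [hasHom_fractionalization_iff hF hd]

theorem bddBelow_fractionalValues {X : ℕ → Type*} (Φ : ∀ n, SimpleGraph (X n))
    (G : SimpleGraph V) : BddBelow (fractionalValues Φ G) :=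
  ⟨0, by rintro _ ⟨n, d, -, -, rfl⟩; positivity⟩

theorem fractionalValues_nonempty (hF : HasEuclideanFixedField F) [Finite V]
    (G : SimpleGraph V) : (fractionalValues (projectiveGraph F) G).Nonempty := by
  obtain ⟨m, ⟨f⟩⟩ := Finite.exists_equiv_fin V
  -- distinct vertices are sent to distinct standard basis vectors
  refine ⟨_, (mem_fractionalValues_iff hF).mpr ⟨m, 1, one_pos,
    ⟨fun v _ => Pi.single (f v) 1, fun v => ⟨fun i => ?_, fun i j hij => ?_⟩,
      fun v w hvw i j => ?_⟩, rfl⟩⟩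
  · exact isOrthonormal_single.unit (f v)
  · exact absurd (Subsingleton.elim i j) hij
  · exact isOrthonormal_single.orth _ _ (f.injective.ne hvw.ne)

theorem HasFrames.fractionalNumber_le (hF : HasEuclideanFixedField F) [Fintype ι] [Nonempty ι]
    {G : SimpleGraph V} (h : HasFrames F G κ ι) :
    fractionalNumber (projectiveGraph F) G ≤ (Fintype.card κ : ℝ) / Fintype.card ι :=
  csInf_le (bddBelow_fractionalValues _ _) ((mem_fractionalValues_iff hF).mpr
    ⟨_, _, Fintype.card_pos, h.reindex (Fintype.equivFin κ) (Fintype.equivFin ι).symm.toEmbedding,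
      rfl⟩)

theorem le_fractionalNumber (hF : HasEuclideanFixedField F) [Finite V] {G : SimpleGraph V} {b : ℝ}
    (h : ∀ n d : ℕ, 0 < d → HasFrames F G (Fin n) (Fin d) → b ≤ (n : ℝ) / d) :
    b ≤ fractionalNumber (projectiveGraph F) G := by
  refine le_csInf (fractionalValues_nonempty hF G) fun q hq => ?_
  obtain ⟨n, d, hd, hf, rfl⟩ := (mem_fractionalValues_iff hF).mp hq
  exact h n d hd hf

theorem fractionalNumber_nonneg {X : ℕ → Type*} (Φ : ∀ n, SimpleGraph (X n))
    (G : SimpleGraph V) : 0 ≤ fractionalNumber Φ G :=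
  Real.sInf_nonneg (by rintro _ ⟨n, d, -, -, rfl⟩; positivity)

end Frames

/-! ### Projective spaces form a linear-like semiring family -/

section Family

variable {F : Type*} [Field F] [StarRing F]

open Matrix

theorem comp_equiv_ne_zero {M : Type*} [Zero M] {κ κ' : Type*} (f : κ ≃ κ') {x : κ → M}
    (hx : x ≠ 0) : x ∘ f.symm ≠ 0 := fun h => hx <| funext fun k => by
  simpa using congrFun h (f k)

theorem isSemiringFamily_projectiveGraph (hF : HasEuclideanFixedField F) :
    IsSemiringFamily (projectiveGraph F) where
  isEmpty_zero := ⟨fun p => p.rep_nonzero (Subsingleton.elim _ _)⟩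
  nonempty_one := ⟨Projectivization.mk F 1 one_ne_zero⟩
  join_hom n m := by
    refine hasHom_projectiveGraph hF
      (fun s => (s.elim (fun p => Sum.elim p.rep 0) fun q => Sum.elim 0 q.rep) ∘
        finSumFinEquiv.symm) ?_ ?_
    · rintro (p | p) <;> refine comp_equiv_ne_zero _ fun h => p.rep_nonzero (funext fun k => ?_)
      · exact congrFun h (.inl k)
      · exact congrFun h (.inr k)
    · rintro (p | p) (q | q) h <;>
        simp only [star_reindex_dotProduct_reindex, Sum.elim_inl, Sum.elim_inr,
          star_sumElim_dotProduct_sumElim, star_zero, zero_dotProduct, dotProduct_zero, add_zero,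
          zero_add]
      · exact (projectiveGraph_adj_iff hF p q).mp h
      · exact (projectiveGraph_adj_iff hF p q).mp h
  disjProd_hom n m := by
    refine hasHom_projectiveGraph hF
      (fun s => (fun k : Fin n × Fin m => s.1.rep k.1 * s.2.rep k.2) ∘ finProdFinEquiv.symm) ?_ ?_
    · rintro ⟨p, q⟩
      refine comp_equiv_ne_zero _ fun h => ?_
      obtain ⟨i, hi⟩ := Function.ne_iff.mp p.rep_nonzero
      obtain ⟨j, hj⟩ := Function.ne_iff.mp q.rep_nonzero
      exact mul_ne_zero hi hj (congrFun h (i, j))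
    · rintro ⟨p, q⟩ ⟨p', q'⟩ (h | h) <;>
        simp only [star_reindex_dotProduct_reindex, star_tensor_dotProduct_tensor]
      · rw [(projectiveGraph_adj_iff hF _ _).mp h, zero_mul]
      · rw [(projectiveGraph_adj_iff hF _ _).mp h, mul_zero]

theorem HomEquivalent.cliqueNumber_eq {V W : Type*} {G : SimpleGraph V} {H : SimpleGraph W}
    (h : HomEquivalent G H) : cliqueNumber G = cliqueNumber H := by
  obtain ⟨⟨f⟩, ⟨g⟩⟩ := h
  exact iSup_congr fun n => iSup_congr_Prop
    ⟨fun ⟨k⟩ => ⟨f.comp k⟩, fun ⟨k⟩ => ⟨g.comp k⟩⟩ fun _ => rfl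

theorem cliqueNumber_projectiveGraph (hF : HasEuclideanFixedField F) (n : ℕ) :
    cliqueNumber (projectiveGraph F n) = n := by
  refine le_antisymm (iSup₂_le fun m ⟨φ⟩ => ?_) ?_
  · choose x hx hmk hu using exists_unit_rep (n := n) hF
    have he : IsOrthonormal fun i => x (φ i) := ⟨fun i => hu _, fun i j hij => by
      have h : (projectiveGraph F n).Adj (φ i) (φ j) := φ.map_adj hij
      rw [← hmk (φ i), ← hmk (φ j)] at h
      exact (projectiveGraph_adj_mk_iff hF _ _ _ _).mp h⟩
    simpa using he.card_le
  · refine le_iSup₂_of_le n ?_ le_rfl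
    exact hasHom_projectiveGraph hF (fun k => Pi.single k 1)
      (fun k => isOrthonormal_single.ne_zero k)
      fun k l h => isOrthonormal_single.orth k l h

/-- A flat of projective space is the set of points of a linear subspace. -/
theorem exists_submodule_of_isFlat (hF : HasEuclideanFixedField F) {n : ℕ}
    {S : Set (ℙ F (Fin n → F))} (hS : IsFlat (projectiveGraph F n) S) :
    ∃ U : Submodule F (Fin n → F),
      ∀ (x : Fin n → F) (hx : x ≠ 0), Projectivization.mk F x hx ∈ S ↔ x ∈ U := by
  refine ⟨{ carrier := {x | ∀ q ∈ perp (projectiveGraph F n) S, star q.rep ⬝ᵥ x = 0}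
            add_mem' := fun {x y} hx hy q hq => by
              rw [dotProduct_add, hx q hq, hy q hq, add_zero]
            zero_mem' := fun q _ => dotProduct_zero _
            smul_mem' := fun c x hx q hq => by
              rw [dotProduct_smul, hx q hq, smul_zero] }, fun x hx => ?_⟩
  conv_lhs => rw [← hS]
  refine forall₂_congr fun q _ => ?_
  conv_lhs => rw [← q.mk_rep]
  rw [projectiveGraph_adj_mk_iff hF, star_dotProduct_eq_zero_comm]

/-- A flat is the projective space of a subspace, and an orthonormal basis identifies the latter
with a standard hermitian space. -/
theorem isLinearLike_projectiveGraph (hF : HasEuclideanFixedField F) :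
    IsLinearLike (projectiveGraph F) := by
  intro n S hS
  obtain ⟨U, hU⟩ := exists_submodule_of_isFlat hF hS
  obtain ⟨b, hb, hs⟩ := exists_isOrthonormal_span_eq hF U
  have hmem : ∀ p : S, p.1.rep ∈ Submodule.span F (Set.range b) := fun p => by
    rw [hs, ← hU _ p.1.rep_nonzero, p.1.mk_rep]
    exact p.2
  have hequiv : HomEquivalent ((projectiveGraph F n).induce S)
      (projectiveGraph F (Module.finrank F U)) := by
    refine ⟨hasHom_projectiveGraph hF (fun p i => star (b i) ⬝ᵥ p.1.rep) (fun p h => ?_)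
      fun p q h => ?_, ?_⟩
    · have h0 := hb.parseval (x := p.1.rep) (hmem p)
      rw [h, dotProduct_zero] at h0
      exact p.1.rep_nonzero (eq_zero_of_star_dotProduct_self hF h0.symm)
    · rw [hb.parseval (hmem q)]
      exact (projectiveGraph_adj_iff hF _ _).mp h
    · have hne : ∀ p : ℙ F (Fin (Module.finrank F U) → F), ∑ i, p.rep i • b i ≠ 0 := fun p h => by
        have h0 := hb.star_sum_dotProduct_sum p.rep p.rep
        rw [h, dotProduct_zero] at h0
        exact p.rep_nonzero (eq_zero_of_star_dotProduct_self hF h0.symm)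
      refine ⟨⟨fun p => ⟨Projectivization.mk F _ (hne p), (hU _ _).mpr ?_⟩, fun {p q} h => ?_⟩⟩
      · exact hs.le (Submodule.sum_mem _ fun i _ =>
          Submodule.smul_mem _ _ (Submodule.subset_span ⟨i, rfl⟩))
      · refine (projectiveGraph_adj_mk_iff hF _ _ _ _).mpr ?_
        rw [hb.star_sum_dotProduct_sum]
        exact (projectiveGraph_adj_iff hF _ _).mp h
  refine ⟨_, ?_, hequiv⟩
  have hS' : perp (projectiveGraph F n) (perp (projectiveGraph F n) S) = S := hS
  rw [rank, hS', hequiv.cliqueNumber_eq, cliqueNumber_projectiveGraph hF]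

end Family

/-! ### The fractional number is semiring-homomorphic -/

section Invariant

variable {F : Type*} [Field F] [StarRing F] {V W : Type*}

open Matrix

theorem fractionalNumber_of_isEmpty (hF : HasEuclideanFixedField F) [IsEmpty V]
    (G : SimpleGraph V) : fractionalNumber (projectiveGraph F) G = 0 := by
  refine le_antisymm ?_ (fractionalNumber_nonneg _ _)
  have h : HasFrames F G (Fin 0) (Fin 1) := ⟨fun v => isEmptyElim v, fun v => isEmptyElim v,
    fun v => isEmptyElim v⟩
  simpa using h.fractionalNumber_le hF

theorem fractionalNumber_of_unique (hF : HasEuclideanFixedField F) [Unique V]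
    (G : SimpleGraph V) : fractionalNumber (projectiveGraph F) G = 1 := by
  refine le_antisymm ?_ (le_fractionalNumber hF ?_)
  · have h : HasFrames F G (Fin 1) (Fin 1) := ⟨fun _ k => Pi.single k 1,
      fun _ => isOrthonormal_single, fun v w h => absurd (Subsingleton.elim v w) h.ne⟩
    simpa using h.fractionalNumber_le hF
  · rintro n d hd ⟨e, he, -⟩
    rw [le_div_iff₀ (by exact_mod_cast hd), one_mul]
    exact_mod_cast by simpa using (he default).card_le

theorem fractionalNumber_mono (hF : HasEuclideanFixedField F) [Finite W] {G : SimpleGraph V}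
    {H : SimpleGraph W} (h : HasHom G H) :
    fractionalNumber (projectiveGraph F) G ≤ fractionalNumber (projectiveGraph F) H := by
  refine le_fractionalNumber hF fun n d hd hH => ?_
  have : Nonempty (Fin d) := ⟨⟨0, hd⟩⟩
  simpa using (hH.of_hom h).fractionalNumber_le hF

theorem exists_frames_lt (hF : HasEuclideanFixedField F) [Finite V] (G : SimpleGraph V) {ε : ℝ}
    (hε : 0 < ε) : ∃ n d : ℕ, 0 < d ∧ HasFrames F G (Fin n) (Fin d) ∧
      (n : ℝ) / d < fractionalNumber (projectiveGraph F) G + ε := by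
  obtain ⟨q, hq, hlt⟩ := Real.lt_sInf_add_pos (fractionalValues_nonempty hF G) hε
  obtain ⟨n, d, hd, h, rfl⟩ := (mem_fractionalValues_iff hF).mp hq
  exact ⟨n, d, hd, h, hlt⟩

theorem fractionalNumber_join_le (hF : HasEuclideanFixedField F) [Finite V] [Finite W]
    (G : SimpleGraph V) (H : SimpleGraph W) :
    fractionalNumber (projectiveGraph F) (join G H) ≤
      fractionalNumber (projectiveGraph F) G + fractionalNumber (projectiveGraph F) H := by
  have key : ∀ n d : ℕ, 0 < d → HasFrames F G (Fin n) (Fin d) → ∀ m e : ℕ, 0 < e →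
      HasFrames F H (Fin m) (Fin e) →
      fractionalNumber (projectiveGraph F) (join G H) ≤ (n : ℝ) / d + (m : ℝ) / e := by
    intro n d hd hG m e he hH
    have : Nonempty (Fin d) := ⟨⟨0, hd⟩⟩
    have : Nonempty (Fin e) := ⟨⟨0, he⟩⟩
    -- the common denominator `d * e` makes the numbers of vectors in the frames equal
    have h := ((hG.scale (Fin e)).join ((hH.scale (Fin d)).reindex (Equiv.refl _)
      (Equiv.prodComm (Fin d) (Fin e)).toEmbedding)).fractionalNumber_le hF
    have hd' : (d : ℝ) ≠ 0 := by exact_mod_cast hd.ne'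
    have he' : (e : ℝ) ≠ 0 := by exact_mod_cast he.ne'
    refine h.trans_eq ?_
    simp only [Fintype.card_sum, Fintype.card_prod, Fintype.card_fin, Nat.cast_add, Nat.cast_mul]
    field_simp
  rw [← sub_le_iff_le_add]
  refine le_fractionalNumber hF fun n d hd hG => ?_
  rw [sub_le_comm]
  refine le_fractionalNumber hF fun m e he hH => ?_
  rw [sub_le_iff_le_add']
  exact key n d hd hG m e he hH

/-- Given frames for the join, the spans of the two sets of frames are orthogonal subspaces, and
`G` and `H` are represented inside of them. -/
theorem add_fractionalNumber_le_join (hF : HasEuclideanFixedField F) [Finite V] [Finite W]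
    (G : SimpleGraph V) (H : SimpleGraph W) :
    fractionalNumber (projectiveGraph F) G + fractionalNumber (projectiveGraph F) H ≤
      fractionalNumber (projectiveGraph F) (join G H) := by
  refine le_fractionalNumber hF ?_
  rintro n d hd ⟨e, he, ho⟩
  have : Nonempty (Fin d) := ⟨⟨0, hd⟩⟩
  let S : Set (Fin n → F) := Set.range fun k : V × Fin d => e (.inl k.1) k.2
  let T : Set (Fin n → F) := Set.range fun k : W × Fin d => e (.inr k.1) k.2
  have hG : HasFrames F G (Fin (Module.finrank F (Submodule.span F S))) (Fin d) :=
    HasFrames.of_mem hF (e := fun v => e (.inl v)) (fun v => he _) (fun v w h => ho _ _ h) _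
      fun v i => Submodule.subset_span ⟨(v, i), rfl⟩
  have hH : HasFrames F H (Fin (Module.finrank F (Submodule.span F T))) (Fin d) :=
    HasFrames.of_mem hF (e := fun v => e (.inr v)) (fun v => he _) (fun v w h => ho _ _ h) _
      fun v i => Submodule.subset_span ⟨(v, i), rfl⟩
  have hST := finrank_add_finrank_le_of_orthogonal hF (orthogonal_span_span (s := S) (t := T) (by
    rintro _ ⟨⟨v, i⟩, rfl⟩ _ ⟨⟨w, j⟩, rfl⟩
    exact ho (.inl v) (.inr w) trivial i j))
  have h1 := add_le_add (hG.fractionalNumber_le hF) (hH.fractionalNumber_le hF)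
  refine h1.trans ?_
  rw [← add_div]
  simp only [Fintype.card_fin] at hST ⊢
  gcongr
  exact_mod_cast hST

theorem fractionalNumber_disjProd_le (hF : HasEuclideanFixedField F) [Finite V] [Finite W]
    (G : SimpleGraph V) (H : SimpleGraph W) :
    fractionalNumber (projectiveGraph F) (disjProd G H) ≤
      fractionalNumber (projectiveGraph F) G * fractionalNumber (projectiveGraph F) H := by
  have key : ∀ n d : ℕ, 0 < d → HasFrames F G (Fin n) (Fin d) → ∀ m e : ℕ, 0 < e →
      HasFrames F H (Fin m) (Fin e) →
      fractionalNumber (projectiveGraph F) (disjProd G H) ≤ ((n : ℝ) / d) * ((m : ℝ) / e) := by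
    intro n d hd hG m e he hH
    have : Nonempty (Fin d) := ⟨⟨0, hd⟩⟩
    have : Nonempty (Fin e) := ⟨⟨0, he⟩⟩
    refine ((hG.disjProd hH).fractionalNumber_le hF).trans_eq ?_
    simp only [Fintype.card_prod, Fintype.card_fin, Nat.cast_mul]
    rw [div_mul_div_comm]
  set a := fractionalNumber (projectiveGraph F) G with ha
  set b := fractionalNumber (projectiveGraph F) H with hb
  have ha0 : 0 ≤ a := fractionalNumber_nonneg _ _
  have hb0 : 0 ≤ b := fractionalNumber_nonneg _ _
  have hlim : Filter.Tendsto (fun ε : ℝ => (a + ε) * (b + ε)) (nhdsWithin 0 (Set.Ioi 0))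
      (nhds (a * b)) := by
    have : Filter.Tendsto (fun ε : ℝ => (a + ε) * (b + ε)) (nhds 0) (nhds ((a + 0) * (b + 0))) :=
      Continuous.tendsto (by fun_prop) 0
    rw [add_zero, add_zero] at this
    exact this.mono_left nhdsWithin_le_nhds
  refine ge_of_tendsto hlim ?_
  filter_upwards [self_mem_nhdsWithin] with ε hε
  obtain ⟨n, d, hd, hG, h1⟩ := exists_frames_lt hF G hε
  obtain ⟨m, e, he, hH, h2⟩ := exists_frames_lt hF H hε
  have hε' : (0 : ℝ) < ε := hε
  exact (key n d hd hG m e he hH).trans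
    (mul_le_mul h1.le h2.le (by positivity) (by positivity))

/-- Given frames for the disjunctive product, the frames over a vertex `v` of `G` span a subspace
in which `H` is represented, and the subspaces of adjacent vertices are orthogonal. So orthonormal
families in these subspaces, of the smallest dimension occurring, represent `G`. -/
theorem mul_fractionalNumber_le_disjProd (hF : HasEuclideanFixedField F) [Finite V] [Finite W]
    (G : SimpleGraph V) (H : SimpleGraph W) :
    fractionalNumber (projectiveGraph F) G * fractionalNumber (projectiveGraph F) H ≤
      fractionalNumber (projectiveGraph F) (disjProd G H) := by
  rcases isEmpty_or_nonempty V with hV | hV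
  · rw [fractionalNumber_of_isEmpty hF G, zero_mul]
    exact fractionalNumber_nonneg _ _
  rcases isEmpty_or_nonempty W with hW | ⟨⟨w₀⟩⟩
  · rw [fractionalNumber_of_isEmpty hF H, mul_zero]
    exact fractionalNumber_nonneg _ _
  refine le_fractionalNumber hF ?_
  rintro n d hd ⟨e, he, ho⟩
  have : Nonempty (Fin d) := ⟨⟨0, hd⟩⟩
  let S : V → Set (Fin n → F) := fun v => Set.range fun k : W × Fin d => e (v, k.1) k.2
  let r : V → ℕ := fun v => Module.finrank F (Submodule.span F (S v))
  have hH : ∀ v, HasFrames F H (Fin (r v)) (Fin d) := fun v =>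
    HasFrames.of_mem hF (e := fun w => e (v, w)) (fun w => he _)
      (fun w w' h => ho _ _ (Or.inr h)) _ fun w i => Submodule.subset_span ⟨(w, i), rfl⟩
  obtain ⟨v₀, hv₀⟩ := Finite.exists_min r
  have hr : 0 < r v₀ := by
    obtain ⟨e', he', -⟩ := hH v₀
    exact hd.trans_le (by simpa using (he' w₀).card_le)
  have : Nonempty (Fin (r v₀)) := ⟨⟨0, hr⟩⟩
  have hG : HasFrames F G (Fin n) (Fin (r v₀)) := by
    choose b hb hs using fun v => exists_isOrthonormal_span_eq hF (Submodule.span F (S v))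
    refine ⟨fun v => b v ∘ Fin.castLE (hv₀ v),
      fun v => (hb v).comp_injective (Fin.castLE_injective _), fun v v' hvv' i j => ?_⟩
    refine orthogonal_span_span (s := S v) (t := S v') ?_ _ ?_ _ ?_
    · rintro _ ⟨⟨w, i⟩, rfl⟩ _ ⟨⟨w', j⟩, rfl⟩
      exact ho (v, w) (v', w') (Or.inl hvv') i j
    · rw [← hs v]; exact Submodule.subset_span ⟨_, rfl⟩
    · rw [← hs v']; exact Submodule.subset_span ⟨_, rfl⟩
  have h1 := hG.fractionalNumber_le hF
  have h2 := (hH v₀).fractionalNumber_le hF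
  simp only [Fintype.card_fin] at h1 h2
  have hr' : (r v₀ : ℝ) ≠ 0 := by exact_mod_cast hr.ne'
  calc _ ≤ ((n : ℝ) / r v₀) * (r v₀ / d) :=
        mul_le_mul h1 h2 (fractionalNumber_nonneg _ _) (by positivity)
    _ = (n : ℝ) / d := by field_simp

theorem isSemiringHomomorphic_fractionalNumber (hF : HasEuclideanFixedField F) :
    IsSemiringHomomorphic.{u} (fun (V : Type u) (G : SimpleGraph V) =>
      fractionalNumber (projectiveGraph F) G) where
  nonneg _ _ _ := fractionalNumber_nonneg _ _
  map_empty _ _ G := fractionalNumber_of_isEmpty hF G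
  map_point _ _ G := fractionalNumber_of_unique hF G
  mono _ _ _ _ _ _ h := fractionalNumber_mono hF h
  map_join _ _ _ _ G H :=
    le_antisymm (fractionalNumber_join_le hF G H) (add_fractionalNumber_le_join hF G H)
  map_disjProd _ _ _ _ G H :=
    le_antisymm (fractionalNumber_disjProd_le hF G H) (mul_fractionalNumber_le_disjProd hF G H)

end Invariant

/-! ### Examples of Euclidean fixed fields -/

section Euclidean

theorem IsEuclideanField.of_ringEquiv {K L : Type*} [Field K] [Field L] (f : K ≃+* L)
    (hL : IsEuclideanField L) : IsEuclideanField K := by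
  obtain ⟨o, ho, hsq⟩ := hL
  let _ : LinearOrder K := LinearOrder.lift' f f.injective
  refine ⟨inferInstance, Function.Injective.isStrictOrderedRing f (map_zero f) (map_one f)
    (map_add f) (map_mul f) Iff.rfl Iff.rfl, fun x hx => ?_⟩
  have hx' : f 0 ≤ f x := hx
  obtain ⟨y, hy⟩ := hsq (f x) (by rwa [map_zero] at hx')
  exact ⟨f.symm y, by rw [← map_mul, ← hy, f.symm_apply_apply]⟩

theorem hasEuclideanFixedField_of_ringHom {R F : Type*} [Field R] [Field F] [StarRing F]
    (φ : R →+* F) (hφ : ∀ x : F, star x = x ↔ x ∈ Set.range φ) (hR : IsEuclideanField R) :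
    HasEuclideanFixedField F := by
  let f : R →+* selfAdjoint F :=
    { toFun := fun a => ⟨φ a, (hφ _).mpr ⟨a, rfl⟩⟩
      map_one' := Subtype.ext (map_one φ)
      map_zero' := Subtype.ext (map_zero φ)
      map_add' := fun a b => Subtype.ext (map_add φ a b)
      map_mul' := fun a b => Subtype.ext (map_mul φ a b) }
  have hf : Function.Bijective f := ⟨f.injective, fun x => by
    obtain ⟨a, ha⟩ := (hφ x).mp x.2
    exact ⟨a, Subtype.ext ha⟩⟩
  exact hR.of_ringEquiv (RingEquiv.ofBijective f hf).symm

theorem isEuclideanField_real : IsEuclideanField ℝ :=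
  ⟨inferInstance, inferInstance, fun x hx => ⟨√x, (Real.mul_self_sqrt hx).symm⟩⟩

theorem hasEuclideanFixedField_real : HasEuclideanFixedField ℝ :=
  hasEuclideanFixedField_of_ringHom (RingHom.id ℝ) (by simp) isEuclideanField_real

theorem hasEuclideanFixedField_complex : HasEuclideanFixedField ℂ :=
  hasEuclideanFixedField_of_ringHom Complex.ofRealHom
    (fun x => by
      rw [← starRingEnd_apply, Complex.conj_eq_iff_real]
      exact exists_congr fun r => eq_comm) isEuclideanField_real

end Euclidean

/-! ### Restriction and extension of scalars -/

section Scalars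

variable {R C : Type*} [Field R] [StarRing R] [Field C] [StarRing C] {V ι κ : Type*} [Fintype κ]

open Matrix

theorem star_map_dotProduct_map (φ : R →+* C) (hφ : ∀ a, star (φ a) = φ (star a))
    (x y : κ → R) : star (fun k => φ (x k)) ⬝ᵥ (fun k => φ (y k)) = φ (star x ⬝ᵥ y) := by
  simp [dotProduct, hφ]

theorem HasFrames.map {G : SimpleGraph V} (φ : R →+* C) (hφ : ∀ a, star (φ a) = φ (star a))
    (hG : HasFrames R G κ ι) : HasFrames C G κ ι := by
  obtain ⟨e, he, ho⟩ := hG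
  refine ⟨fun v i k => φ (e v i k), fun v => ⟨fun i => ?_, fun i j hij => ?_⟩,
    fun v w hvw i j => ?_⟩
  · rw [star_map_dotProduct_map φ hφ, (he v).unit, map_one]
  · rw [star_map_dotProduct_map φ hφ, (he v).orth i j hij, map_zero]
  · rw [star_map_dotProduct_map φ hφ, ho v w hvw, map_zero]

variable [TrivialStar R]

/-- Restriction of scalars from `C = R(i)` to `R`: with a vector `x + i y` the frame contains
`(x, y)` and the multiple by `i`, which is `(-y, x)`. The products of these four kinds are, up to
sign, the real and the imaginary part of the hermitian form. -/
theorem HasFrames.restrictScalars {G : SimpleGraph V} (φ : R →+* C) (hφ : ∀ a, star (φ a) = φ a)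
    (I : C) (hI : I * I = -1) (hIs : star I = -I) (h2 : (2 : C) ≠ 0)
    (hC : ∀ c, ∃ a b, c = φ a + I * φ b) (hG : HasFrames C G κ ι) :
    HasFrames R G (κ ⊕ κ) (ι ⊕ ι) := by
  obtain ⟨e, he, ho⟩ := hG
  choose re im hri using hC
  have hI0 : I ≠ 0 := by
    rintro rfl
    simp at hI
  have hform : ∀ x y : κ → C, star x ⬝ᵥ y =
      φ (∑ k, (re (x k) * re (y k) + im (x k) * im (y k))) +
        I * φ (∑ k, (re (x k) * im (y k) - im (x k) * re (y k))) := by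
    intro x y
    rw [map_sum, map_sum, Finset.mul_sum, ← Finset.sum_add_distrib, dotProduct]
    refine Finset.sum_congr rfl fun k _ => ?_
    rw [Pi.star_apply]
    conv_lhs => rw [hri (x k), hri (y k)]
    simp only [star_add, star_mul, hφ, hIs, map_add, map_mul, map_sub]
    linear_combination (-φ (im (x k)) * φ (im (y k))) * hI
  have huniq : ∀ a b a' b', φ a + I * φ b = φ a' + I * φ b' → a = a' ∧ b = b' := by
    intro a b a' b' h
    have h' := congrArg star h
    simp only [star_add, star_mul, hφ, hIs] at h'
    constructor
    · refine φ.injective (mul_left_cancel₀ h2 ?_)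
      linear_combination h + h'
    · refine φ.injective (mul_left_cancel₀ h2 (mul_left_cancel₀ hI0 ?_))
      linear_combination h - h'
  have hpart : ∀ (x y : κ → C) (c : R), star x ⬝ᵥ y = φ c →
      ∑ k, (re (x k) * re (y k) + im (x k) * im (y k)) = c ∧
        ∑ k, (re (x k) * im (y k) - im (x k) * re (y k)) = 0 := by
    intro x y c h
    refine huniq _ _ _ _ ?_
    rw [← hform, h, map_zero, mul_zero, add_zero]
  let f : V → ι ⊕ ι → κ ⊕ κ → R := fun v =>
    Sum.elim (fun i => Sum.elim (fun k => re (e v i k)) (fun k => im (e v i k)))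
      (fun i => Sum.elim (fun k => -im (e v i k)) (fun k => re (e v i k)))
  have hll : ∀ v w i j c, star (e v i) ⬝ᵥ e w j = φ c →
      star (f v (.inl i)) ⬝ᵥ f w (.inl j) = c := by
    intro v w i j c h
    rw [← (hpart _ _ c h).1]
    simp [f, dotProduct, Finset.sum_add_distrib]
  have hrr : ∀ v w i j c, star (e v i) ⬝ᵥ e w j = φ c →
      star (f v (.inr i)) ⬝ᵥ f w (.inr j) = c := by
    intro v w i j c h
    rw [← (hpart _ _ c h).1]
    simp [f, dotProduct, Finset.sum_add_distrib, add_comm]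
  have hlr : ∀ v w i j c, star (e v i) ⬝ᵥ e w j = φ c →
      star (f v (.inl i)) ⬝ᵥ f w (.inr j) = 0 := by
    intro v w i j c h
    rw [← neg_eq_zero, ← (hpart _ _ c h).2]
    simp [f, dotProduct, Finset.sum_add_distrib, sub_eq_add_neg, add_comm]
  have hrl : ∀ v w i j c, star (e v i) ⬝ᵥ e w j = φ c →
      star (f v (.inr i)) ⬝ᵥ f w (.inl j) = 0 := by
    intro v w i j c h
    rw [← (hpart _ _ c h).2]
    simp [f, dotProduct, Finset.sum_add_distrib, sub_eq_add_neg]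
    ring
  refine ⟨f, fun v => ⟨?_, ?_⟩, fun v w hvw => ?_⟩
  · rintro (i | i)
    · exact hll _ _ _ _ 1 (by rw [(he v).unit, map_one])
    · exact hrr _ _ _ _ 1 (by rw [(he v).unit, map_one])
  · rintro (i | i) (j | j) hij
    · exact hll _ _ _ _ 0 (by rw [(he v).orth _ _ fun h => hij (congrArg _ h), map_zero])
    · rcases eq_or_ne i j with rfl | h
      · exact hlr _ _ _ _ 1 (by rw [(he v).unit, map_one])
      · exact hlr _ _ _ _ 0 (by rw [(he v).orth _ _ h, map_zero])
    · rcases eq_or_ne i j with rfl | h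
      · exact hrl _ _ _ _ 1 (by rw [(he v).unit, map_one])
      · exact hrl _ _ _ _ 0 (by rw [(he v).orth _ _ h, map_zero])
    · exact hrr _ _ _ _ 0 (by rw [(he v).orth _ _ fun h => hij (congrArg _ h), map_zero])
  · have h0 : ∀ i j, star (e v i) ⬝ᵥ e w j = φ 0 := fun i j => by rw [ho v w hvw, map_zero]
    rintro (i | i) (j | j)
    · exact hll _ _ _ _ 0 (h0 i j)
    · exact hlr _ _ _ _ 0 (h0 i j)
    · exact hrl _ _ _ _ 0 (h0 i j)
    · exact hrr _ _ _ _ 0 (h0 i j)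

/-- If `C = R(i)` with the involution fixing `R` and negating `i`, then `C` and `R` have the same
fractional numbers: frames over `R` are frames over `C`, and restriction of scalars doubles both
the dimension and the number of vectors. -/
theorem fractionalNumber_eq_of_quadratic (hR : HasEuclideanFixedField R)
    (hC : HasEuclideanFixedField C) (φ : R →+* C) (hφ : ∀ a, star (φ a) = φ a)
    (I : C) (hI : I * I = -1) (hIs : star I = -I) (hspan : ∀ c, ∃ a b, c = φ a + I * φ b)
    [Finite V] (G : SimpleGraph V) :
    fractionalNumber (projectiveGraph C) G = fractionalNumber (projectiveGraph R) G := by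
  refine le_antisymm (le_fractionalNumber hR fun n d hd h => ?_)
    (le_fractionalNumber hC fun n d hd h => ?_)
  · have : Nonempty (Fin d) := ⟨⟨0, hd⟩⟩
    simpa using (h.map φ fun a => by rw [hφ, star_trivial]).fractionalNumber_le hC
  · have : Nonempty (Fin d) := ⟨⟨0, hd⟩⟩
    refine ((h.restrictScalars φ hφ I hI hIs (two_ne_zero_of_hasEuclideanFixedField hC)
      hspan).fractionalNumber_le hR).trans_eq ?_
    have hd' : (d : ℝ) ≠ 0 := by exact_mod_cast hd.ne'
    simp only [Fintype.card_sum, Fintype.card_fin, Nat.cast_add]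
    field_simp

end Scalars

theorem fractionalNumber_complex_eq_real {V : Type*} [Finite V] (G : SimpleGraph V) :
    fractionalNumber (projectiveGraph ℂ) G = fractionalNumber (projectiveGraph ℝ) G :=
  fractionalNumber_eq_of_quadratic hasEuclideanFixedField_real hasEuclideanFixedField_complex
    Complex.ofRealHom (fun a => Complex.conj_ofReal a) Complex.I Complex.I_mul_I Complex.conj_I
    (fun c => ⟨c.re, c.im, by
      rw [mul_comm]
      exact (Complex.re_add_im c).symm⟩) G

/-! ### Projective rank -/

section ProjectiveRank

open Matrix
open scoped ComplexOrder

variable {V : Type*}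

/-- A projection of rank `r` is the same thing as its range, and a frame is an orthonormal basis
of this range. -/
theorem exists_isProjectiveRepresentation_iff {G : SimpleGraph V} {d r : ℕ} :
    (∃ P, IsProjectiveRepresentation G d r P) ↔ HasFrames ℂ G (Fin d) (Fin r) := by
  constructor
  · rintro ⟨P, hP, hPG⟩
    have hrank : ∀ v, Module.finrank ℂ (LinearMap.range (P v).mulVecLin) = r := fun v => (hP v).2
    have hb : ∀ v, ∃ e : Fin r → Fin d → ℂ, IsOrthonormal e ∧
        ∀ i, e i ∈ LinearMap.range (P v).mulVecLin := by
      intro v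
      obtain ⟨e, he, hs⟩ := exists_isOrthonormal_span_eq hasEuclideanFixedField_complex
        (LinearMap.range (P v).mulVecLin)
      rw [← hrank v]
      exact ⟨e, he, fun i => hs.le (Submodule.subset_span ⟨i, rfl⟩)⟩
    choose e he hmem using hb
    refine ⟨e, he, fun v w hvw i j => ?_⟩
    -- `⟨P v x, P w y⟩ = ⟨x, P v P w y⟩ = 0`
    obtain ⟨x, hx⟩ := hmem v i
    obtain ⟨y, hy⟩ := hmem w j
    rw [← hx, ← hy, mulVecLin_apply, mulVecLin_apply, star_mulVec, ← dotProduct_mulVec,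
      mulVec_mulVec, ← star_eq_conjTranspose, (hP v).1.isSelfAdjoint.star_eq, hPG v w hvw,
      zero_mulVec, dotProduct_zero]
  · rintro ⟨e, he, ho⟩
    -- the projection with a given orthonormal basis of its range, as the columns of `E`, is `E * Eᴴ`
    let E : V → Matrix (Fin d) (Fin r) ℂ := fun v => of fun k i => e v i k
    have hE : ∀ v, (E v)ᴴ * E v = 1 := fun v => by
      ext i j
      rw [one_apply, ← (he v).eq_ite]
      rfl
    refine ⟨fun v => E v * (E v)ᴴ, fun v => ⟨⟨?_, ?_⟩, ?_⟩, fun v w hvw => ?_⟩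
    · change E v * (E v)ᴴ * (E v * (E v)ᴴ) = E v * (E v)ᴴ
      rw [Matrix.mul_assoc, ← Matrix.mul_assoc (E v)ᴴ, hE, Matrix.one_mul]
    · change (E v * (E v)ᴴ)ᴴ = E v * (E v)ᴴ
      rw [conjTranspose_mul, conjTranspose_conjTranspose]
    · rw [rank_self_mul_conjTranspose, ← rank_conjTranspose_mul_self, hE, rank_one,
        Fintype.card_fin]
    · have h0 : (E v)ᴴ * E w = 0 := by
        ext i j
        exact ho v w hvw i j
      change E v * (E v)ᴴ * (E w * (E w)ᴴ) = 0
      rw [Matrix.mul_assoc, ← Matrix.mul_assoc (E v)ᴴ, h0, Matrix.zero_mul, Matrix.mul_zero]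

theorem fractionalNumber_complex_eq_projectiveRank (G : SimpleGraph V) :
    fractionalNumber (projectiveGraph ℂ) G = projectiveRank G := by
  rw [fractionalNumber, projectiveRank]
  congr 1
  ext q
  rw [mem_fractionalValues_iff hasEuclideanFixedField_complex]
  simp only [Set.mem_ofPred_eq, exists_isProjectiveRepresentation_iff]

end ProjectiveRank

/-! ### Real closed fields -/

section RealClosed

open Polynomial IntermediateField

variable {R : Type*} [Field R]

theorem isSquare_add_of_isRealClosed [IsRealClosed R] {x y : R} (hx : IsSquare x)
    (hy : IsSquare y) : IsSquare (x + y) := by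
  rcases IsRealClosed.isSquare_or_isSquare_neg (x + y) with h | ⟨c, hc⟩
  · exact h
  obtain ⟨a, rfl⟩ := hx
  obtain ⟨b, rfl⟩ := hy
  have hsum : a * a + b * b + c * c = 0 := by linear_combination -hc
  -- otherwise dividing by `a * a` makes `-1` a sum of two squares
  rcases eq_or_ne a 0 with rfl | ha
  · exact ⟨b, by ring⟩
  · refine absurd ?_ (IsSemireal.one_add_ne_zero (R := R)
      ((IsSumSq.mul_self (b / a)).add (IsSumSq.mul_self (c / a))))
    field_simp
    linear_combination hsum

/-- In a real closed field the squares are the nonnegative elements for a linear order. -/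
theorem isEuclideanField_of_isRealClosed [IsRealClosed R] : IsEuclideanField R := by
  classical
  let C : RingCone R :=
    { carrier := {x | IsSquare x}
      mul_mem' := fun ha hb => IsSquare.mul ha hb
      one_mem' := IsSquare.one
      add_mem' := fun ha hb => isSquare_add_of_isRealClosed ha hb
      zero_mem' := IsSquare.zero
      eq_zero_of_mem_of_neg_mem' := by
        rintro _ ⟨a, rfl⟩ ⟨b, hb⟩
        by_contra h0
        have ha : a ≠ 0 := fun h => h0 (by rw [h, zero_mul])
        refine IsSemireal.one_add_ne_zero (R := R) (IsSumSq.mul_self (b / a)) ?_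
        field_simp
        linear_combination -hb }
  have : HasMemOrNegMem C := ⟨fun a => IsRealClosed.isSquare_or_isSquare_neg a⟩
  let _ : LinearOrder R := .mkOfAddGroupCone C
  have : IsOrderedRing R := .mkOfCone C
  refine ⟨inferInstance, IsOrderedRing.toIsStrictOrderedRing R, fun x hx => ?_⟩
  have hx' : x - 0 ∈ C := hx
  rw [sub_zero] at hx'
  exact hx'

theorem finrank_eq_one_of_odd [IsRealClosed R] (L : Type*) [Field L] [Algebra R L]
    [FiniteDimensional R L] (h : Odd (Module.finrank R L)) : Module.finrank R L = 1 := by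
  obtain ⟨α, hα⟩ := Field.exists_primitive_element R L
  have hint : IsIntegral R α := .of_finite R α
  have hdeg : (minpoly R α).natDegree = Module.finrank R L := by
    rw [← IntermediateField.adjoin.finrank hint, hα, finrank_top']
  rw [← hdeg] at h ⊢
  obtain ⟨x, hx⟩ := IsRealClosed.exists_isRoot_of_odd_natDegree h
  exact natDegree_eq_of_degree_eq_some
    (degree_eq_one_of_irreducible_of_root (minpoly.irreducible hint) hx)

theorem finrank_ne_two_of_forall_isSquare {K M : Type*} [Field K] [Field M] [Algebra K M]
    (h2 : (2 : K) ≠ 0) (hsq : ∀ x : K, IsSquare x) : Module.finrank K M ≠ 2 := by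
  intro h
  have : FiniteDimensional K M := Module.finite_of_finrank_eq_succ h
  have key : ∀ α : M, α ∈ (⊥ : IntermediateField K M) := by
    intro α
    by_contra hα
    have hd : Module.finrank K K⟮α⟯ ∣ 2 := h ▸ ⟨_, (Module.finrank_mul_finrank K K⟮α⟯ M).symm⟩
    have hint : IsIntegral K α := .of_finite K α
    have hdeg : (minpoly K α).natDegree = 2 := by
      rcases (Nat.dvd_prime Nat.prime_two).mp hd with h1 | h1
      · rw [IntermediateField.finrank_eq_one_iff, adjoin_simple_eq_bot_iff] at h1
        exact absurd h1 hα
      · rw [← h1, IntermediateField.adjoin.finrank hint]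
    obtain ⟨s, hs⟩ := hsq ((minpoly K α).coeff 1 ^ 2 - 4 * (minpoly K α).coeff 0)
    have hroot : aeval α (minpoly K α) = 0 := minpoly.aeval K α
    have hlc : (minpoly K α).coeff 2 = 1 := by rw [← hdeg]; exact minpoly.monic hint
    rw [aeval_eq_sum_range, hdeg, Finset.sum_range_succ, Finset.sum_range_succ,
      Finset.sum_range_one, hlc] at hroot
    simp only [Algebra.smul_def, map_one, pow_zero, pow_one, mul_one, one_mul] at hroot
    have hs' := congrArg (algebraMap K M) hs
    simp only [map_sub, map_mul, map_pow, map_ofNat] at hs'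
    have h2' : (2 : M) ≠ 0 := by
      rw [← map_ofNat (algebraMap K M) 2]
      exact (_root_.map_ne_zero _).mpr h2
    -- completing the square
    have hsquare : (2 * α + algebraMap K M ((minpoly K α).coeff 1)) *
        (2 * α + algebraMap K M ((minpoly K α).coeff 1)) =
        algebraMap K M s * algebraMap K M s := by
      linear_combination 4 * hroot + hs'
    apply hα
    rw [IntermediateField.mem_bot]
    rcases mul_self_eq_mul_self_iff.mp hsquare with h' | h'
    · refine ⟨(s - (minpoly K α).coeff 1) / 2, ?_⟩
      rw [map_div₀, map_sub, map_ofNat]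
      field_simp
      linear_combination -h'
    · refine ⟨(-s - (minpoly K α).coeff 1) / 2, ?_⟩
      rw [map_div₀, map_sub, map_neg, map_ofNat]
      field_simp
      linear_combination -h'
  have hbot : (⊥ : IntermediateField K M) = ⊤ := eq_top_iff.mpr fun α _ => key α
  have h1 : Module.finrank K M = 1 := by
    rw [← finrank_top' (F := K) (E := M), ← hbot, IntermediateField.finrank_bot]
  omega

/-- In `R(i)` every element `a + b i` is a square: the real and the imaginary part of a root have the
squares `(r + a) / 2` and `(r - a) / 2`, where `r` is the absolute value. -/
theorem isSquare_add_mul_I [LinearOrder R] [IsStrictOrderedRing R]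
    (hsq : ∀ x : R, 0 ≤ x → IsSquare x) {K : Type*} [Field K] [Algebra R K] {I : K}
    (hI : I * I = -1) (a b : R) : IsSquare (algebraMap R K a + algebraMap R K b * I) := by
  obtain ⟨r₀, hr₀⟩ := hsq (a * a + b * b) (add_nonneg (mul_self_nonneg a) (mul_self_nonneg b))
  obtain ⟨r, hr, hr0⟩ : ∃ r, a * a + b * b = r * r ∧ 0 ≤ r :=
    ⟨|r₀|, by rw [abs_mul_abs_self, hr₀], abs_nonneg _⟩
  have habs : |a| ≤ r := abs_le_of_sq_le_sq (by nlinarith [mul_self_nonneg b]) hr0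
  obtain ⟨x, hx⟩ := hsq ((r + a) / 2) (by linarith [neg_abs_le a])
  obtain ⟨y, hy⟩ := hsq ((r - a) / 2) (by linarith [le_abs_self a])
  have hxy : (2 * x * y) * (2 * x * y) = b * b := by
    linear_combination -hr - 4 * x * x * hy - 4 * hx * ((r - a) / 2)
  have hmain : ∀ y', y' * y' = (r - a) / 2 → 2 * x * y' = b →
      IsSquare (algebraMap R K a + algebraMap R K b * I) := by
    intro y' hy' hb
    refine ⟨algebraMap R K x + algebraMap R K y' * I, ?_⟩
    have ha : a = x * x - y' * y' := by linear_combination hx + hy'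
    rw [← hb, ha]
    simp only [map_sub, map_mul, map_ofNat]
    linear_combination (-(algebraMap R K y') * (algebraMap R K y')) * hI
  rcases mul_self_eq_mul_self_iff.mp hxy with h | h
  · exact hmain y hy.symm h
  · exact hmain (-y) (by linear_combination -hy) (by linear_combination -h)

/-- Irreducible polynomials over a real closed field have degree at most two. Let `L` be a Galois
extension containing a root and a square root `I` of `-1`. The fixed field of a Sylow 2-subgroup has
odd degree, so it is `R` and the degree of `L` is a power of two. If `L` were larger than `R(I)`, it
would contain a quadratic extension of `R(I)`, where every element is a square. -/
theorem natDegree_le_two_of_irreducible [IsRealClosed R] {p : R[X]} (hp : Irreducible p) :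
    p.natDegree ≤ 2 := by
  obtain ⟨o, ho, hsq⟩ := isEuclideanField_of_isRealClosed (R := R)
  have hX : (X ^ 2 + 1 : R[X]) ≠ 0 := (monic_X_pow_add_C (1 : R) two_ne_zero).ne_zero
  let g : R[X] := p * (X ^ 2 + 1)
  have hg : g ≠ 0 := mul_ne_zero hp.ne_zero hX
  let L := g.SplittingField
  have hsplit : (g.map (algebraMap R L)).Splits := SplittingField.splits g
  have hroot : ∀ q : R[X], q ∣ g → q.natDegree ≠ 0 → ∃ α : L, aeval α q = 0 := by
    intro q hq hdeg
    obtain ⟨α, hα⟩ := (hsplit.of_dvd (map_ne_zero hg) (map_dvd _ hq)).exists_eval_eq_zero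
      (by rw [degree_map]; exact fun h => hdeg (natDegree_eq_of_degree_eq_some h))
    exact ⟨α, by rwa [eval_map_algebraMap] at hα⟩
  obtain ⟨α, hα⟩ := hroot p (dvd_mul_right _ _) hp.natDegree_pos.ne'
  obtain ⟨I, hI'⟩ := hroot (X ^ 2 + 1) (dvd_mul_left _ _)
    (by rw [← C_1, natDegree_X_pow_add_C]; norm_num)
  have hI : I * I = -1 := by
    simp only [map_add, map_pow, aeval_X, map_one] at hI'
    linear_combination hI'
  have hnormal : Normal R L := Normal.of_isSplittingField g
  have hgal : IsGalois R L := ⟨⟩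
  -- the degree of `L` is a power of two
  obtain ⟨k, hk⟩ : ∃ k, Module.finrank R L = 2 ^ k := by
    have : Fact (Nat.Prime 2) := ⟨Nat.prime_two⟩
    let P : Sylow 2 Gal(L/R) := default
    have hodd : Odd (Module.finrank R (fixedField P.1)) := by
      have h1 := Module.finrank_mul_finrank R (fixedField P.1) L
      rw [finrank_fixedField_eq_card, ← IsGalois.card_aut_eq_finrank R L,
        ← P.1.index_mul_card] at h1
      have h2 := Nat.eq_of_mul_eq_mul_right Nat.card_pos h1
      rw [h2, ← Nat.not_even_iff_odd, even_iff_two_dvd]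
      exact P.not_dvd_index
    have h1 := Module.finrank_mul_finrank R (fixedField P.1) L
    rw [finrank_eq_one_of_odd _ hodd, one_mul, finrank_fixedField_eq_card] at h1
    obtain ⟨k, hk⟩ := P.2.exists_card_eq
    exact ⟨k, by rw [← h1, ← hk]⟩
  -- every element of `R(I)` has the form `a + b I` and is therefore a square
  have hKmem : ∀ x : R⟮I⟯, ∃ a b : R, (x : L) = algebraMap R L a + algebraMap R L b * I := by
    rintro ⟨x, hx⟩
    have hx' : x ∈ Algebra.adjoin R {I} := by
      rwa [← adjoin_simple_toSubalgebra_of_isAlgebraic (Algebra.IsAlgebraic.isAlgebraic I),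
        mem_toSubalgebra]
    change ∃ a b : R, x = algebraMap R L a + algebraMap R L b * I
    clear hx
    induction hx' using Algebra.adjoin_induction with
    | mem x hx =>
      obtain rfl : x = I := hx
      exact ⟨0, 1, by simp⟩
    | algebraMap r => exact ⟨r, 0, by simp⟩
    | add x y _ _ hx hy =>
      obtain ⟨a, b, h⟩ := hx
      obtain ⟨c, d, h'⟩ := hy
      refine ⟨a + c, b + d, ?_⟩
      rw [h, h', map_add, map_add]
      ring
    | mul x y _ _ hx hy =>
      obtain ⟨a, b, h⟩ := hx
      obtain ⟨c, d, h'⟩ := hy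
      refine ⟨a * c - b * d, a * d + b * c, ?_⟩
      rw [h, h', map_add, map_sub, map_mul, map_mul, map_mul, map_mul]
      linear_combination (algebraMap R L b * algebraMap R L d) * hI
  have hKsq : ∀ x : R⟮I⟯, IsSquare x := by
    intro x
    obtain ⟨a, b, hab⟩ := hKmem x
    have hI2 : (⟨I, mem_adjoin_simple_self R I⟩ : R⟮I⟯) * ⟨I, mem_adjoin_simple_self R I⟩ = -1 :=
      Subtype.ext hI
    have := isSquare_add_mul_I hsq hI2 a b
    convert this
    exact Subtype.ext hab
  have hK2 : (2 : R⟮I⟯) ≠ 0 := by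
    rw [← map_ofNat (algebraMap R R⟮I⟯) 2]
    exact (_root_.map_ne_zero _).mpr two_ne_zero
  have htop : Module.finrank R⟮I⟯ L = 1 := by
    have hdvd : Module.finrank R⟮I⟯ L ∣ 2 ^ k :=
      hk ▸ ⟨_, by rw [mul_comm, Module.finrank_mul_finrank R R⟮I⟯ L]⟩
    obtain ⟨j, -, hj⟩ := (Nat.dvd_prime_pow Nat.prime_two).mp hdvd
    rcases j with - | j
    · simpa using hj
    exfalso
    have : Fact (Nat.Prime 2) := ⟨Nat.prime_two⟩
    rw [← IsGalois.card_aut_eq_finrank R⟮I⟯ L] at hj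
    -- a subgroup of index two has a quadratic extension of `R(I)` as its fixed field
    obtain ⟨H, hH⟩ := Sylow.exists_subgroup_card_pow_prime (G := Gal(L/R⟮I⟯)) 2 (n := j)
      (by rw [hj]; exact pow_dvd_pow 2 (Nat.le_succ j))
    have h1 := Module.finrank_mul_finrank R⟮I⟯ (fixedField H) L
    rw [finrank_fixedField_eq_card, hH, ← IsGalois.card_aut_eq_finrank R⟮I⟯ L, hj, pow_succ',
      mul_left_inj' (pow_ne_zero _ two_ne_zero)] at h1
    exact finrank_ne_two_of_forall_isSquare hK2 hKsq h1
  have hKdeg : Module.finrank R R⟮I⟯ ≤ 2 := by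
    rw [IntermediateField.adjoin.finrank (IsIntegral.of_finite R I)]
    refine (natDegree_le_of_dvd (minpoly.dvd R I hI') hX).trans ?_
    rw [← C_1, natDegree_X_pow_add_C]
  have hLdeg : Module.finrank R L ≤ 2 := by
    rw [← Module.finrank_mul_finrank R R⟮I⟯ L, htop, mul_one]
    exact hKdeg
  have hle : Module.finrank R R⟮α⟯ ≤ Module.finrank R L :=
    Submodule.finrank_le (R⟮α⟯.toSubalgebra.toSubmodule)
  rw [IntermediateField.adjoin.finrank (IsIntegral.of_finite R α),
    ← natDegree_eq_of_degree_eq (degree_eq_degree_of_associated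
      ((minpoly.irreducible (IsIntegral.of_finite R α)).associated_of_dvd hp
        (minpoly.dvd R α hα)).symm)] at hle
  omega

/-- The intermediate value theorem for polynomials. A polynomial that changes sign has an
irreducible factor that changes sign, and a quadratic polynomial without roots does not. -/
theorem exists_isRoot_of_eval_mul_eval_neg [IsRealClosed R] [LinearOrder R]
    [IsStrictOrderedRing R] {a b : R} (f : R[X]) (h : f.eval a * f.eval b < 0) :
    ∃ x, f.IsRoot x := by
  induction f using WfDvdMonoid.induction_on_irreducible with
  | zero => simp at h
  | unit u hu =>
    obtain ⟨c, hc, rfl⟩ := isUnit_iff.mp hu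
    rw [eval_C, eval_C] at h
    exact absurd h (mul_self_nonneg c).not_gt
  | mul f p hf hp ih =>
    rw [eval_mul, eval_mul] at h
    by_cases hfa : f.eval a * f.eval b < 0
    · obtain ⟨x, hx⟩ := ih hfa
      exact ⟨x, by simp [hx.eq_zero]⟩
    have hpa : p.eval a * p.eval b < 0 := by
      by_contra hpa
      push Not at hfa hpa
      nlinarith [mul_nonneg hfa hpa]
    suffices ∃ x, p.IsRoot x by
      obtain ⟨x, hx⟩ := this
      exact ⟨x, by simp [hx.eq_zero]⟩
    have hdeg := natDegree_le_two_of_irreducible hp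
    have hquad : ∀ x, p.eval x = p.coeff 2 * x ^ 2 + p.coeff 1 * x + p.coeff 0 := by
      intro x
      rw [eval_eq_sum_range' (Nat.lt_succ_of_le hdeg), Finset.sum_range_succ,
        Finset.sum_range_succ, Finset.sum_range_one]
      ring
    set A := p.coeff 2
    set B := p.coeff 1
    set D := p.coeff 0
    rcases eq_or_ne A 0 with hA | hA
    · rcases eq_or_ne B 0 with hB | hB
      · rw [hquad, hquad, hA, hB] at hpa
        nlinarith [mul_self_nonneg D]
      · refine ⟨-D / B, ?_⟩
        rw [IsRoot.def, hquad, hA]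
        field_simp
        ring
    · by_cases hdisc : 0 ≤ B ^ 2 - 4 * A * D
      · obtain ⟨s, hs⟩ := IsRealClosed.nonneg_iff_isSquare.mp hdisc
        refine ⟨(-B + s) / (2 * A), ?_⟩
        rw [IsRoot.def, hquad]
        field_simp
        linear_combination -hs
      · push Not at hdisc
        exfalso
        -- `4 A p(x) = (2 A x + B) ^ 2 - (B ^ 2 - 4 A D)`, so `A p(x)` is always positive
        have hpos : ∀ x, 0 < 4 * A * p.eval x := by
          intro x
          rw [hquad]
          nlinarith [sq_nonneg (2 * A * x + B)]
        have h1 := mul_pos (hpos a) (hpos b)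
        have h2 : 0 < 16 * A ^ 2 := by positivity
        nlinarith

end RealClosed

/-! ### Specializing real points to real closed fields -/

section Specialization

open Polynomial

/-- Elements `S` of a field that are integral over a domain `B` of characteristic zero become,
after multiplication by a common denominator `D`, polynomials in one integral element `α`. -/
theorem exists_integral_common_denominator {B E : Type*} [CommRing B] [IsDomain B] [CharZero B]
    [Field E] [Algebra B E] [FaithfulSMul B E] (S : Finset E) (hS : ∀ x ∈ S, IsIntegral B x) :
    ∃ α : E, IsIntegral B α ∧ ∃ D : B, D ≠ 0 ∧
      ∀ a ∈ Submodule.span B (S : Set E), ∃ q : B[X], aeval α q = D • a := by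
  classical
  let K := FractionRing B
  let _ : Algebra K E := FractionRing.liftAlgebra B E
  have : IsScalarTower B K E := FractionRing.isScalarTower_liftAlgebra B E
  have : CharZero K := charZero_of_injective_algebraMap (IsFractionRing.injective B K)
  let L := IntermediateField.adjoin K (S : Set E)
  have : FiniteDimensional K L := by
    have : Finite (S : Set E) := S.finite_toSet
    exact IntermediateField.finiteDimensional_adjoin fun x hx => (hS x hx).tower_top
  obtain ⟨x, hx⟩ := Field.exists_primitive_element K L
  have hxK : IsAlgebraic K (x : E) :=
    (Algebra.IsAlgebraic.isAlgebraic (R := K) x).algebraMap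
  obtain ⟨y, hy, hα⟩ := ((IsFractionRing.isAlgebraic_iff B K E).mpr hxK).exists_integral_multiple
  have hyK : algebraMap B K y ≠ 0 := (_root_.map_ne_zero_iff _ (IsFractionRing.injective B K)).mpr hy
  have hsingle : ∀ a ∈ S, ∃ D : B, D ≠ 0 ∧ ∃ q : B[X], aeval (y • (x : E)) q = D • a := by
    intro a ha
    have haL : (⟨a, IntermediateField.subset_adjoin K _ ha⟩ : L) ∈
        (IntermediateField.adjoin K {x}).toSubalgebra := by
      rw [hx]; trivial
    rw [IntermediateField.adjoin_simple_toSubalgebra_of_isAlgebraic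
      (Algebra.IsAlgebraic.isAlgebraic x), Algebra.adjoin_singleton_eq_range_aeval] at haL
    obtain ⟨p, hp⟩ := haL
    have hp' : aeval (x : E) p = a := by
      have := congrArg (algebraMap L E) hp
      change algebraMap L E (aeval x p) = _ at this
      rw [← aeval_algebraMap_apply] at this
      exact this
    set p' : K[X] := p.comp (C (algebraMap B K y)⁻¹ * X) with hp'def
    have hp'' : aeval (y • (x : E)) p' = a := by
      rw [hp'def, aeval_comp, map_mul, aeval_C, aeval_X, ← hp', ← Algebra.smul_def,
        ← IsScalarTower.algebraMap_smul K y (x : E), smul_smul, inv_mul_cancel₀ hyK, one_smul]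
    obtain ⟨b, hb, hbp⟩ := IsLocalization.integerNormalization_spec (nonZeroDivisors B) p'
    refine ⟨b, nonZeroDivisors.ne_zero hb,
      IsLocalization.integerNormalization (nonZeroDivisors B) p', ?_⟩
    rw [← aeval_map_algebraMap K, hbp, ← IsScalarTower.algebraMap_smul K b p', map_smul, hp'',
      IsScalarTower.algebraMap_smul]
  choose! d hd q hq using hsingle
  refine ⟨y • (x : E), hα, ∏ a ∈ S, d a, Finset.prod_ne_zero_iff.mpr hd, fun a ha => ?_⟩
  induction ha using Submodule.span_induction with
  | mem a ha =>
    refine ⟨C (∏ b ∈ S.erase a, d b) * q a, ?_⟩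
    rw [map_mul, aeval_C, hq a ha, ← Algebra.smul_def, smul_smul, Finset.prod_erase_mul _ _ ha]
  | zero => exact ⟨0, by simp⟩
  | add a b _ _ ha hb =>
    obtain ⟨q₁, h₁⟩ := ha
    obtain ⟨q₂, h₂⟩ := hb
    exact ⟨q₁ + q₂, by rw [map_add, h₁, h₂, smul_add]⟩
  | smul c a _ ha =>
    obtain ⟨q₁, h₁⟩ := ha
    exact ⟨C c * q₁, by rw [map_mul, aeval_C, h₁, ← Algebra.smul_def, smul_comm]⟩

/-- A real polynomial changes sign between rational points around a simple root. -/
theorem exists_rat_eval_mul_eval_neg {f : ℝ[X]} {θ : ℝ} (hθ : f.eval θ = 0)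
    (hθ' : f.derivative.eval θ ≠ 0) : ∃ a b : ℚ, f.eval (a : ℝ) * f.eval (b : ℝ) < 0 := by
  -- `f = (X - θ) g` with `g θ ≠ 0`, and `g` keeps its sign near `θ`
  obtain ⟨g, hg⟩ := dvd_iff_isRoot.mpr hθ
  have hgθ : g.eval θ ≠ 0 := by
    rw [hg] at hθ'
    simpa using hθ'
  have hpos : ∀ᶠ x in nhds θ, 0 < g.eval x * g.eval θ := by
    refine ContinuousAt.eventually_lt (f := fun _ => (0 : ℝ)) continuousAt_const ?_ ?_
    · exact (g.continuous.mul continuous_const).continuousAt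
    · exact mul_self_pos.mpr hgθ
  obtain ⟨ε, hε, hball⟩ := Metric.eventually_nhds_iff.mp hpos
  obtain ⟨a, ha, ha'⟩ := exists_rat_btwn (show θ - ε < θ by linarith)
  obtain ⟨b, hb, hb'⟩ := exists_rat_btwn (show θ < θ + ε by linarith)
  have h1 := hball (y := a) (by rw [Real.dist_eq, abs_lt]; constructor <;> linarith)
  have h2 := hball (y := b) (by rw [Real.dist_eq, abs_lt]; constructor <;> linarith)
  refine ⟨a, b, ?_⟩
  have h3 : 0 < g.eval (a : ℝ) * g.eval (b : ℝ) := by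
    have : 0 < (g.eval (a : ℝ) * g.eval (b : ℝ)) * (g.eval θ * g.eval θ) := by
      calc 0 < _ := mul_pos h1 h2
        _ = _ := by ring
    exact pos_of_mul_pos_left this (mul_self_nonneg _)
  have h4 : ((a : ℝ) - θ) * (b - θ) < 0 := mul_neg_of_neg_of_pos (by linarith) (by linarith)
  calc f.eval (a : ℝ) * f.eval (b : ℝ)
      = ((a : ℝ) - θ) * (b - θ) * (g.eval (a : ℝ) * g.eval (b : ℝ)) := by
        rw [hg]; simp only [eval_mul, eval_sub, eval_X, eval_C]; ring
    _ < 0 := mul_neg_of_neg_of_pos h4 h3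

/-- A sign change of a polynomial depending on real parameters persists when the parameters are
replaced by nearby rational numbers. -/
theorem exists_rat_specialization {s : ℕ} (t : Fin s → ℝ) {D : MvPolynomial (Fin s) ℚ}
    (hD : MvPolynomial.aeval t D ≠ 0) (f : (MvPolynomial (Fin s) ℚ)[X]) {θ : ℝ}
    (hθ : (f.map (MvPolynomial.aeval t).toRingHom).eval θ = 0)
    (hθ' : (f.map (MvPolynomial.aeval t).toRingHom).derivative.eval θ ≠ 0) :
    ∃ (t' : Fin s → ℚ) (a b : ℚ), MvPolynomial.eval t' D ≠ 0 ∧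
      (f.map (MvPolynomial.eval t')).eval a * (f.map (MvPolynomial.eval t')).eval b < 0 := by
  obtain ⟨a, b, hab⟩ := exists_rat_eval_mul_eval_neg hθ hθ'
  let P : MvPolynomial (Fin s) ℚ := f.eval (MvPolynomial.C a) * f.eval (MvPolynomial.C b)
  have hev : ∀ c : ℚ, (f.map (MvPolynomial.aeval t).toRingHom).eval (c : ℝ) =
      MvPolynomial.aeval t (f.eval (MvPolynomial.C c)) := by
    intro c
    have h := eval_map_apply (MvPolynomial.aeval (R := ℚ) t).toRingHom (p := f) (MvPolynomial.C c)
    simpa using h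
  have hP : MvPolynomial.aeval t P < 0 := by
    rw [map_mul, ← hev, ← hev]
    exact hab
  have hcont : ∀ Q : MvPolynomial (Fin s) ℚ,
      Continuous fun u : Fin s → ℝ => MvPolynomial.aeval u Q := by
    intro Q
    have h := MvPolynomial.continuous_eval (Q.map (algebraMap ℚ ℝ))
    simpa only [MvPolynomial.eval_map, ← MvPolynomial.aeval_def] using h
  have hdense : DenseRange fun (u : Fin s → ℚ) (i : Fin s) => (u i : ℝ) :=
    DenseRange.piMap (f := fun _ => ((↑) : ℚ → ℝ)) fun _ => Rat.denseRange_cast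
  obtain ⟨t', ht'⟩ := hdense.exists_mem_open
    (((isOpen_lt (hcont P) continuous_const)).inter
      (isOpen_ne_fun (hcont D) continuous_const)) ⟨t, hP, hD⟩
  have hcast : ∀ Q : MvPolynomial (Fin s) ℚ,
      MvPolynomial.aeval (fun i => (t' i : ℝ)) Q = ((MvPolynomial.eval t' Q : ℚ) : ℝ) := by
    intro Q
    exact MvPolynomial.aeval_algebraMap_apply ℝ t' Q
  obtain ⟨h1, h2⟩ := ht'
  refine ⟨t', a, b, fun h => h2 (by rw [hcast, h, Rat.cast_zero]), ?_⟩
  have h1' : MvPolynomial.aeval (fun i => (t' i : ℝ)) P < 0 := h1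
  rw [hcast, Rat.cast_lt_zero, map_mul] at h1'
  have hev' : ∀ c : ℚ, (f.map (MvPolynomial.eval t')).eval c =
      MvPolynomial.eval t' (f.eval (MvPolynomial.C c)) := by
    intro c
    have h := eval_map_apply (MvPolynomial.eval t') (p := f) (MvPolynomial.C c)
    simpa using h
  rwa [hev', hev']

/-- A form of the Artin–Lang theorem: a finitely generated subring of `ℝ` over `ℚ` has a
homomorphism to every real closed field. By Noether normalization the ring is finite over a
polynomial ring `B`, and up to a denominator it is contained in `B[α]`. The real point given by the
inclusion is a simple root of the minimal polynomial of `α`, so there is a sign change, which is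
kept at nearby rational parameters, where it yields a root in the real closed field. -/
theorem exists_ringHom_of_fg {A : Subalgebra ℚ ℝ} (hA : A.FG) (R : Type*) [Field R]
    [IsRealClosed R] : Nonempty (A →+* R) := by
  have : Algebra.FiniteType ℚ A := A.fg_iff_finiteType.mp hA
  obtain ⟨s, g, hg, hfin⟩ := exists_finite_inj_algHom_of_fg ℚ A
  let B := MvPolynomial (Fin s) ℚ
  let _ : Algebra B A := g.toRingHom.toAlgebra
  have : Module.Finite B A := hfin
  let _ : Algebra B ℝ := ((algebraMap A ℝ).comp g.toRingHom).toAlgebra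
  have : IsScalarTower B A ℝ := .of_algebraMap_eq' rfl
  have hinj : Function.Injective (algebraMap B ℝ) := Subtype.val_injective.comp hg
  have : FaithfulSMul B ℝ := (faithfulSMul_iff_algebraMap_injective B ℝ).mpr hinj
  -- the inclusion of `B` is evaluation at a point `t` with algebraically independent coordinates
  let t : Fin s → ℝ := fun i => algebraMap B ℝ (MvPolynomial.X i)
  have hτ : algebraMap B ℝ = (MvPolynomial.aeval (R := ℚ) t).toRingHom := by
    refine MvPolynomial.ringHom_ext (fun r => ?_) fun i => ?_
    · have h1 : algebraMap B ℝ (MvPolynomial.C r) = algebraMap ℚ ℝ r :=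
        congrArg (algebraMap A ℝ) (g.commutes r)
      exact h1.trans ((MvPolynomial.aeval (R := ℚ) t).commutes r).symm
    · simp [t]
  classical
  obtain ⟨S₀, hS₀⟩ := Module.finite_def.mp (inferInstance : Module.Finite B A)
  let S : Finset ℝ := S₀.image (algebraMap A ℝ)
  have hmem : ∀ a : A, (a : ℝ) ∈ Submodule.span B (S : Set ℝ) := by
    intro a
    have h1 : a ∈ Submodule.span B (S₀ : Set A) := by rw [hS₀]; trivial
    have h2 := Submodule.mem_map_of_mem (f := (IsScalarTower.toAlgHom B A ℝ).toLinearMap) h1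
    rw [Submodule.map_span] at h2
    simpa [S] using h2
  have hSint : ∀ x ∈ S, IsIntegral B x := by
    intro x hx
    obtain ⟨a, -, rfl⟩ := Finset.mem_image.mp hx
    exact (IsIntegral.of_finite B a).algebraMap
  obtain ⟨α, hα, D, hD, hq⟩ := exists_integral_common_denominator S hSint
  choose q hq using fun a : A => hq a (hmem a)
  set f := minpoly B α with hf
  have hroot : (f.map (MvPolynomial.aeval t).toRingHom).eval α = 0 := by
    rw [← hτ, eval_map_algebraMap, minpoly.aeval]
  have hsimple : (f.map (MvPolynomial.aeval t).toRingHom).derivative.eval α ≠ 0 := by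
    let K := FractionRing B
    let _ : Algebra K ℝ := FractionRing.liftAlgebra B ℝ
    have : IsScalarTower B K ℝ := FractionRing.isScalarTower_liftAlgebra B ℝ
    have : CharZero K := charZero_of_injective_algebraMap (IsFractionRing.injective B K)
    have hsep : (minpoly K α).Separable := (minpoly.irreducible hα.tower_top).separable
    have hne := hsep.aeval_derivative_ne_zero (minpoly.aeval K α)
    rw [minpoly.isIntegrallyClosed_eq_field_fractions' K hα, derivative_map,
      aeval_map_algebraMap] at hne
    rwa [← hτ, derivative_map, eval_map_algebraMap]
  have hDt : MvPolynomial.aeval t D ≠ 0 := by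
    have h : algebraMap B ℝ D ≠ 0 := (_root_.map_ne_zero_iff _ hinj).mpr hD
    rwa [hτ] at h
  obtain ⟨t', a, b, hD', hab⟩ := exists_rat_specialization t hDt f hroot hsimple
  obtain ⟨o, ho, -⟩ := isEuclideanField_of_isRealClosed (R := R)
  let ψ₀ : B →+* R := (algebraMap ℚ R).comp (MvPolynomial.eval t')
  obtain ⟨ρ, hρ⟩ : ∃ ρ, (f.map ψ₀).IsRoot ρ := by
    refine exists_isRoot_of_eval_mul_eval_neg (a := (a : R)) (b := (b : R)) _ ?_
    have hev : ∀ c : ℚ, (f.map ψ₀).eval (c : R) = ((f.map (MvPolynomial.eval t')).eval c : ℚ) := by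
      intro c
      rw [← Polynomial.map_map]
      exact eval_map_apply (algebraMap ℚ R) c
    rw [hev, hev, ← Rat.cast_mul]
    exact Rat.cast_lt_zero.mpr hab
  -- evaluation of polynomials at `ρ` factors through `B[α]`
  let ψ : B[X] →+* R := eval₂RingHom ψ₀ ρ
  have hψ : ∀ p p' : B[X], aeval α p = aeval α p' → ψ p = ψ p' := by
    intro p p' h
    obtain ⟨r, hr⟩ := minpoly.isIntegrallyClosed_dvd hα (p := p - p') (by rw [map_sub, h, sub_self])
    rw [← sub_eq_zero, ← map_sub, hr, map_mul]
    have : ψ f = 0 := by rwa [IsRoot.def, eval_map] at hρ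
    rw [← hf, this, zero_mul]
  have hD0 : ψ (C D) ≠ 0 := by
    change eval₂ ψ₀ ρ (C D) ≠ 0
    rw [eval₂_C]
    exact (_root_.map_ne_zero (algebraMap ℚ R)).mpr hD'
  -- writing `D x = (q x)(α)`, the homomorphism sends `x` to `(q x)(ρ) / D(t')`
  refine ⟨RingHom.mk' ⟨⟨fun x => ψ (q x) / ψ (C D), ?_⟩, fun x y => ?_⟩ fun x y => ?_⟩
  · rw [div_eq_one_iff_eq hD0]
    refine hψ _ _ ?_
    rw [hq, aeval_C, Algebra.smul_def, OneMemClass.coe_one, mul_one]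
  · change ψ (q (x * y)) / ψ (C D) = ψ (q x) / ψ (C D) * (ψ (q y) / ψ (C D))
    have h : ψ (C D * q (x * y)) = ψ (q x * q y) := by
      refine hψ _ _ ?_
      rw [map_mul, map_mul, hq, hq, hq, aeval_C, MulMemClass.coe_mul]
      simp only [Algebra.smul_def]
      ring
    rw [map_mul, map_mul] at h
    field_simp
    linear_combination h
  · change ψ (q (x + y)) / ψ (C D) = ψ (q x) / ψ (C D) + ψ (q y) / ψ (C D)
    rw [← add_div, ← map_add]
    congr 1
    refine hψ _ _ ?_
    rw [map_add, hq, hq, hq, AddMemClass.coe_add, smul_add]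

end Specialization

/-! ### Independence of the real closed field -/

section Transfer

open Matrix

variable {R R' : Type*} [Field R] [StarRing R] [TrivialStar R] [Field R'] [StarRing R']
  [TrivialStar R'] {V ι κ : Type*} [Fintype κ]

/-- Frames can be transported along a ring homomorphism that is defined only on a subring
containing all their coordinates. -/
theorem HasFrames.of_subring {G : SimpleGraph V} {S : Type*} [SetLike S R] [SubringClass S R]
    (A : S) (φ : A →+* R') {e : V → ι → κ → R} (he : ∀ v, IsOrthonormal (e v))
    (ho : ∀ v w, G.Adj v w → ∀ i j, star (e v i) ⬝ᵥ e w j = 0) (hA : ∀ v i k, e v i k ∈ A) :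
    HasFrames R' G κ ι := by
  let f : V → ι → κ → R' := fun v i k => φ ⟨e v i k, hA v i k⟩
  have key : ∀ v w i j (c : A), star (e v i) ⬝ᵥ e w j = c → star (f v i) ⬝ᵥ f w j = φ c := by
    intro v w i j c h
    have h' : ∑ k, (⟨e v i k, hA v i k⟩ : A) * ⟨e w j k, hA w j k⟩ = c := by
      apply Subtype.ext
      rw [← h, AddSubmonoidClass.coe_finsetSum]
      simp [dotProduct]
    rw [← h', map_sum]
    simp only [f, dotProduct, Pi.star_apply, star_trivial, map_mul]
  refine ⟨f, fun v => ⟨fun i => ?_, fun i j hij => ?_⟩, fun v w hvw i j => ?_⟩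
  · rw [key v v i i 1 (by rw [(he v).unit, OneMemClass.coe_one]), map_one]
  · rw [key v v i j 0 (by rw [(he v).orth i j hij, ZeroMemClass.coe_zero]), map_zero]
  · rw [key v w i j 0 (by rw [ho v w hvw, ZeroMemClass.coe_zero]), map_zero]

theorem HasFrames.of_real {G : SimpleGraph V} [Finite V] [Finite ι] [IsRealClosed R]
    (hG : HasFrames ℝ G κ ι) : HasFrames R G κ ι := by
  obtain ⟨e, he, ho⟩ := hG
  let c : V × ι × κ → ℝ := fun k => e k.1 k.2.1 k.2.2
  obtain ⟨φ⟩ := exists_ringHom_of_fg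
    (Subalgebra.fg_def.mpr ⟨_, Set.finite_range c, rfl⟩) R
  exact HasFrames.of_subring _ φ he ho fun v i k => Algebra.subset_adjoin ⟨(v, i, k), rfl⟩

/-- The coordinates of unit vectors lie in `[-1, 1]`, so the standard part of an ordered field
applies to them. -/
theorem HasFrames.to_real {G : SimpleGraph V} [LinearOrder R] [IsStrictOrderedRing R]
    (hG : HasFrames R G κ ι) : HasFrames ℝ G κ ι := by
  obtain ⟨e, he, ho⟩ := hG
  -- the subring of finite elements
  let A : Subring R :=
    { carrier := {x | 0 ≤ ArchimedeanClass.mk x}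
      mul_mem' := fun {a b} ha hb => by
        rw [Set.mem_ofPred_eq, ArchimedeanClass.mk_mul]
        exact add_nonneg ha hb
      one_mem' := by simp
      add_mem' := fun {a b} ha hb => by
        rw [Set.mem_ofPred_eq]
        exact (le_min ha hb).trans (ArchimedeanClass.min_le_mk_add a b)
      zero_mem' := by simp
      neg_mem' := fun {a} ha => by
        rw [Set.mem_ofPred_eq, ArchimedeanClass.mk_neg]
        exact ha }
  let φ : A →+* ℝ :=
    { toFun := fun a => ArchimedeanClass.stdPart (a : R)
      map_one' := ArchimedeanClass.stdPart_one
      map_zero' := ArchimedeanClass.stdPart_zero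
      map_mul' := fun a b => ArchimedeanClass.stdPart_mul a.2 b.2
      map_add' := fun a b => ArchimedeanClass.stdPart_add a.2 b.2 }
  refine HasFrames.of_subring A φ he ho fun v i k => ?_
  have h1 : e v i k * e v i k ≤ 1 := by
    rw [← (he v).unit i, dotProduct]
    simp only [star_trivial]
    exact Finset.single_le_sum (f := fun k => e v i k * e v i k)
      (fun k _ => mul_self_nonneg _) (Finset.mem_univ k)
  have h2 : |e v i k| ≤ |(1 : R)| := by
    rw [abs_one]
    exact abs_le_one_iff_mul_self_le_one.mpr h1
  change 0 ≤ ArchimedeanClass.mk (e v i k)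
  rw [← ArchimedeanClass.mk_one (R := R)]
  exact ArchimedeanClass.mk_le_mk_of_abs h2

theorem hasEuclideanFixedField_of_isRealClosed [IsRealClosed R] : HasEuclideanFixedField R :=
  hasEuclideanFixedField_of_ringHom (RingHom.id R) (by simp) isEuclideanField_of_isRealClosed

theorem fractionalNumber_eq_real_of_isRealClosed [IsRealClosed R] [Finite V]
    (G : SimpleGraph V) :
    fractionalNumber (projectiveGraph R) G = fractionalNumber (projectiveGraph ℝ) G := by
  obtain ⟨o, ho, -⟩ := isEuclideanField_of_isRealClosed (R := R)
  rw [fractionalNumber, fractionalNumber]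
  congr 1
  ext q
  rw [mem_fractionalValues_iff hasEuclideanFixedField_of_isRealClosed,
    mem_fractionalValues_iff hasEuclideanFixedField_real]
  exact exists_congr fun n => exists_congr fun d => and_congr_right fun _ =>
    and_congr_left fun _ => ⟨HasFrames.to_real, HasFrames.of_real⟩

/-- An involution whose fixed field is a proper real closed subfield `R` is the conjugation of
`R(i)`: the square of a skew element is the negative of a square of `R`. -/
theorem exists_imaginary_unit {R C : Type*} [Field R] [IsRealClosed R] [Field C] [StarRing C]
    [Algebra R C] (hne : ∃ c : C, c ∉ Set.range (algebraMap R C))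
    (hstar : ∀ x : C, star x = x ↔ x ∈ Set.range (algebraMap R C)) :
    ∃ I : C, I * I = -1 ∧ star I = -I ∧
      ∀ c, ∃ a b, c = algebraMap R C a + I * algebraMap R C b := by
  have h2 : (2 : C) ≠ 0 := by
    rw [← map_ofNat (algebraMap R C) 2]
    exact (map_ne_zero _).mpr two_ne_zero
  have hfix : ∀ a, star (algebraMap R C a) = algebraMap R C a := fun a => (hstar _).mpr ⟨a, rfl⟩
  obtain ⟨c, hc⟩ := hne
  set k := c - star c with hk
  have hks : star k = -k := by rw [hk, star_sub, star_star, neg_sub]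
  have hk0 : k ≠ 0 := fun h => hc ((hstar c).mp (sub_eq_zero.mp h).symm)
  obtain ⟨a, ha⟩ := (hstar (k * k)).mp (by rw [star_mul, hks, neg_mul_neg])
  have hnsq : ¬ IsSquare a := by
    rintro ⟨s, rfl⟩
    rw [map_mul] at ha
    have hself : star k = k := by
      rcases mul_self_eq_mul_self_iff.mp ha.symm with h | h
      · rw [h, hfix]
      · rw [h, star_neg, hfix]
    rw [hks] at hself
    exact (mul_ne_zero h2 hk0) (by linear_combination -hself)
  obtain ⟨s, hs⟩ := IsRealClosed.isSquare_neg_of_not_isSquare hnsq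
  have hs0 : algebraMap R C s ≠ 0 := by
    rw [map_ne_zero]
    rintro rfl
    exact hnsq ⟨0, by linear_combination -hs⟩
  have hs' : -(k * k) = algebraMap R C s * algebraMap R C s := by
    rw [← ha, ← map_mul, ← hs, map_neg]
  have hI : k / algebraMap R C s * (k / algebraMap R C s) = -1 := by
    field_simp
    linear_combination -hs'
  have hIs : star (k / algebraMap R C s) = -(k / algebraMap R C s) := by
    rw [star_div₀, hks, hfix, neg_div]
  refine ⟨k / algebraMap R C s, hI, hIs, fun c => ?_⟩
  set I := k / algebraMap R C s
  have hI0 : I ≠ 0 := div_ne_zero hk0 hs0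
  have hs2 : star (2 : C) = 2 := star_ofNat 2
  obtain ⟨x, hx⟩ := (hstar ((c + star c) / 2)).mp (by
    rw [star_div₀, star_add, star_star, hs2, add_comm])
  obtain ⟨y, hy⟩ := (hstar ((c - star c) / (2 * I))).mp (by
    rw [star_div₀, star_sub, star_star, star_mul, hs2, hIs]
    field_simp
    ring)
  refine ⟨x, y, ?_⟩
  rw [hx, hy]
  field_simp
  ring

end Transfer

end GraphInvariant

theorem mainTheorem4 :
    -- every field with involution whose fixed field is Euclidean
    (∀ (F : Type v) [Field F] [StarRing F], GraphInvariant.HasEuclideanFixedField F →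
      (∀ (n : ℕ) (x y : Fin n → F) (hx : x ≠ 0) (hy : y ≠ 0),
        (GraphInvariant.projectiveGraph F n).Adj
            (Projectivization.mk F x hx) (Projectivization.mk F y hy) ↔
          GraphInvariant.hermForm x y = 0) ∧
      (∀ n : ℕ,
        GraphInvariant.HomEquivalent (GraphInvariant.projectiveGraph F n)
          (GraphInvariant.vectorGraph {x : Fin n → F | x ≠ 0}) ∧
        GraphInvariant.HomEquivalent (GraphInvariant.projectiveGraph F n)
          (GraphInvariant.vectorGraph {x : Fin n → F | GraphInvariant.hermForm x x = 1})) ∧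
      GraphInvariant.IsSemiringFamily (GraphInvariant.projectiveGraph F) ∧
      GraphInvariant.IsLinearLike (GraphInvariant.projectiveGraph F) ∧
      (∀ (V : Type u) [Finite V] (G : SimpleGraph V),
        (GraphInvariant.fractionalValues (GraphInvariant.projectiveGraph F) G).Nonempty) ∧
      GraphInvariant.IsSemiringHomomorphic.{u} (fun (V : Type u) (G : SimpleGraph V) =>
        GraphInvariant.fractionalNumber (GraphInvariant.projectiveGraph F) G)) ∧
    -- the complex numbers give the projective rank, and the real numbers give the same invariant
    (GraphInvariant.HasEuclideanFixedField ℂ ∧ GraphInvariant.HasEuclideanFixedField ℝ ∧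
      ∀ (V : Type u) [Finite V] (G : SimpleGraph V),
        GraphInvariant.fractionalNumber (GraphInvariant.projectiveGraph ℂ) G =
          GraphInvariant.projectiveRank G ∧
        GraphInvariant.fractionalNumber (GraphInvariant.projectiveGraph ℝ) G =
          GraphInvariant.projectiveRank G) ∧
    -- real closed fields with the trivial involution
    (∀ (R : Type v) [Field R] [IsRealClosed R] [StarRing R] [TrivialStar R],
      GraphInvariant.HasEuclideanFixedField R ∧
      ∀ (V : Type u) [Finite V] (G : SimpleGraph V),
        GraphInvariant.fractionalNumber (GraphInvariant.projectiveGraph R) G =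
          GraphInvariant.fractionalNumber (GraphInvariant.projectiveGraph ℝ) G) ∧
    -- quadratic extensions of real closed fields with the nontrivial automorphism as involution
    (∀ (R : Type w) (C : Type v) [Field R] [IsRealClosed R] [Field C] [StarRing C] [Algebra R C]
      [Algebra.IsQuadraticExtension R C],
      (∀ x : C, star x = x ↔ x ∈ Set.range (algebraMap R C)) →
      GraphInvariant.HasEuclideanFixedField C ∧
      ∀ (V : Type u) [Finite V] (G : SimpleGraph V),
        GraphInvariant.fractionalNumber (GraphInvariant.projectiveGraph C) G =
          GraphInvariant.fractionalNumber (GraphInvariant.projectiveGraph ℂ) G) := by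

  refine ⟨fun F _ _ hF => ⟨fun n x y hx hy => ?_, fun n => ⟨?_, ?_⟩, ?_, ?_, fun V _ G => ?_, ?_⟩,
    ⟨?_, ?_, fun V _ G => ⟨?_, ?_⟩⟩, fun R _ _ _ _ => ⟨?_, fun V _ G => ?_⟩,
    fun R C _ _ _ _ _ _ hstar => ?_⟩
  · exact GraphInvariant.projectiveGraph_adj_mk_iff hF x y hx hy
  · exact GraphInvariant.homEquivalent_vectorGraph_ne_zero hF
  · exact GraphInvariant.homEquivalent_vectorGraph_unit hF
  · exact GraphInvariant.isSemiringFamily_projectiveGraph hF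
  · exact GraphInvariant.isLinearLike_projectiveGraph hF
  · exact GraphInvariant.fractionalValues_nonempty hF G
  · exact GraphInvariant.isSemiringHomomorphic_fractionalNumber hF
  · exact GraphInvariant.hasEuclideanFixedField_complex
  · exact GraphInvariant.hasEuclideanFixedField_real
  · exact GraphInvariant.fractionalNumber_complex_eq_projectiveRank G
  · rw [← GraphInvariant.fractionalNumber_complex_eq_real,
      GraphInvariant.fractionalNumber_complex_eq_projectiveRank]
  · exact GraphInvariant.hasEuclideanFixedField_of_isRealClosed
  · exact GraphInvariant.fractionalNumber_eq_real_of_isRealClosed G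
  · have hC : GraphInvariant.HasEuclideanFixedField C :=
      GraphInvariant.hasEuclideanFixedField_of_ringHom (algebraMap R C) hstar
        GraphInvariant.isEuclideanField_of_isRealClosed
    refine ⟨hC, fun V _ G => ?_⟩
    have hne : ∃ c : C, c ∉ Set.range (algebraMap R C) := by
      by_contra! hsurj
      have h1 : Module.finrank R C = 1 :=
        (LinearEquiv.ofBijective (Algebra.linearMap R C)
          ⟨(algebraMap R C).injective, hsurj⟩).finrank_eq.symm.trans (Module.finrank_self R)
      have h2 := Algebra.IsQuadraticExtension.finrank_eq_two R C
      omega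
    obtain ⟨I, hI, hIs, hspan⟩ := GraphInvariant.exists_imaginary_unit hne hstar
    let _ : StarRing R := starRingOfComm
    have : TrivialStar R := ⟨fun _ => rfl⟩
    rw [GraphInvariant.fractionalNumber_eq_of_quadratic
        GraphInvariant.hasEuclideanFixedField_of_isRealClosed hC (algebraMap R C)
        (fun a => (hstar _).mpr ⟨a, rfl⟩) I hI hIs hspan G,
      GraphInvariant.fractionalNumber_eq_real_of_isRealClosed,
      GraphInvariant.fractionalNumber_complex_eq_real]
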